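/- **Setting.** Let $(\Omega,\mathcal F)$ be a measurable space, $\Omega\neq\emptyset$, with a filtration $(\mathcal F_t)_{t\in\mathbb N}$, $t=0,1,2,\dots$, such that $\mathcal F_0=\{\emptyset,\Omega\}$ and $\mathcal F=\sigma(\bigcup_t\mathcal F_t)$. Let $\mathcal H$ be a linear space of $\mathcal F$-measurable functions $\Omega\to\mathbb R$ that contains the constants and such that $X\in\mathcal H$ implies $|X|\in\mathcal H$ and $I_AX\in\mathcal H$ for all $A\in\mathcal F$. Let $\mathcal H_t$ be the set of $\mathcal F_t$-measurable elements of $\mathcal H$. Let $\mathcal E_t:\mathcal H\to\mathcal H_t$, $t\in\mathbb N$, be an $\mathcal{SL}$-expectation, i.e. for all $X,Y\in\mathcal H$ and $s\le t$: (1) $X\ge Y$ implies $\mathcal E_t(X)\ge\mathcal E_t(Y)$; (2) $\mathcal E_s(Y)=\mathcal E_s(\mathcal E_t(Y))$; (3) $\mathcal E_t(I_AY)=I_A\mathcal E_t(Y)$ for $A\in\mathcal F_t$; (4) $\mathcal E_t(Y)=Y$ for $Y\in\mathcal H_t$; (5) $\mathcal E_t(X+Y)\le\mathcal E_t(X)+\mathcal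 E_t(Y)$; (6) $\mathcal E_t(\lambda Y)=\lambda^+\mathcal E_t(Y)+\lambda^-\mathcal E_t(-Y)$ for $\lambda\in\mathcal H_t$ with $\lambda Y\in\mathcal H$; (7) if $X_i\in\mathcal H$ and $X_i(\omega)\downarrow0$ for every $\omega$, then $\mathcal E_0(X_i)\to0$. As $\mathcal F_0$ is trivial, $\mathcal E:=\mathcal E_0$ is real-valued. Put $\mathbb V(A)=\mathcal E(I_A)$ for $A\in\mathcal F$. A property holds *quasi-surely* (q.s.) if it holds outside some $N\in\mathcal F$ with $\mathbb V(N)=0$. For $X,Y\in\mathcal H$, $X$ is *independent of* $Y$ if for every measurable $\varphi:\mathbb R^2\to\mathbb R$ with $\varphi(Y,X)\in\mathcal H$ and $\varphi(y,X)\in\mathcal H$ for all $y\in\mathbb R$, putting $\overline\varphi(y):=\mathcal E(\varphi(y,X))$, one has $\overline\varphi(Y)\in\mathcal H$ and $\mathcal E(\varphi(Y,X))=\mathcal E(\overline\varphi(Y))$. $X$ is independent of $\mathcal F_n$ if it is independent of $I_A$ for every $A\in\mathcal F_n$. $X$ and $Y$ have the *same distribution* if $\mathcal E(\varphi(X))=\mathcal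 E(\varphi(Y))$ for every measurable $\varphi:\mathbb R\to\mathbb R$ with $\varphi(X),\varphi(Y)\in\mathcal H$. *Assumption (A):* for every sequence $Y_1,Y_2,\dots$ in $\mathcal H$ and every $B\in\sigma(Y_k,k\ge1)$ there are $B_n\in\sigma(Y_1,\dots,Y_n)$, $n\ge 1$, with $\lim_{n\to\infty}\mathbb V(B_n\triangle B)=0$. **Theorem.** Let $X_1,X_2,\dots$ be such that, for each $i\ge1$, $X_i\in\mathcal H_i$, $X_i$ is independent of $\mathcal F_{i-1}$, and $X_i$ has the same distribution as $X_1$. Assume $$\sum_{m=1}^\infty\mathcal E\big(|X_1|I_{\{m-1<|X_1|\le m\}}\big)<\infty ,$$ and let $S_n=X_1+\dots+X_n$. Then: (i) if $\mathcal E(X_1)=-\mathcal E(-X_1)$, then $S_n/n\to\mathcal E(X_1)$ q.s.; (ii) if $S_n/n$ converges q.s. to some $X\in\mathcal H$ and Assumption (A) holds, then $\mathcal E(X_1)=-\mathcal E(-X_1)$ and $X=\mathcal E(X_1)$ q.s. -/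

import Mathlib

open MeasureTheory Filter Topology

namespace SublinearLLN

variable {Ω : Type*}

/-- A linear space `H` of real-valued measurable functions on `Ω` that contains the constants and is
closed under absolute values and under multiplication by indicators of measurable sets. -/
structure IsRandomVariableSpace [MeasurableSpace Ω] (H : Submodule ℝ (Ω → ℝ)) : Prop where
  measurable : ∀ X ∈ H, Measurable X
  const_mem : ∀ c : ℝ, (fun _ : Ω => c) ∈ H
  abs_mem : ∀ X ∈ H, (fun ω => |X ω|) ∈ H
  indicator_mem : ∀ X ∈ H, ∀ A : Set Ω, MeasurableSet A → A.indicator X ∈ H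

/-- `H_t`: the elements of `H` that are measurable with respect to the sub-σ-algebra `ℱ t`. -/
def adaptedPart [mΩ : MeasurableSpace Ω] (ℱ : Filtration ℕ mΩ) (H : Submodule ℝ (Ω → ℝ)) (t : ℕ) :
    Set (Ω → ℝ) :=
  {X | X ∈ H ∧ Measurable[ℱ t] X}

/-- A family of maps `E t : H → H_t` that is an `𝒮ℒ`-expectation: an `ℱ`-consistent sublinear
expectation with the monotone continuity property. The maps `E t` are written as total functions on
`Ω → ℝ`; all requirements, here and in the notions below, concern their values on `H` only. -/
structure IsSLExpectation [mΩ : MeasurableSpace Ω] (ℱ : Filtration ℕ mΩ) (H : Submodule ℝ (Ω → ℝ))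
    (E : ℕ → (Ω → ℝ) → (Ω → ℝ)) : Prop where
  mapsTo : ∀ t, ∀ X ∈ H, E t X ∈ adaptedPart ℱ H t
  mono : ∀ t, ∀ X ∈ H, ∀ Y ∈ H, Y ≤ X → E t Y ≤ E t X
  tower : ∀ s t, s ≤ t → ∀ Y ∈ H, E s Y = E s (E t Y)
  indicator : ∀ t, ∀ A : Set Ω, MeasurableSet[ℱ t] A → ∀ Y ∈ H,
    E t (A.indicator Y) = A.indicator (E t Y)
  eq_self : ∀ t, ∀ Y ∈ adaptedPart ℱ H t, E t Y = Y
  subadd : ∀ t, ∀ X ∈ H, ∀ Y ∈ H, E t (X + Y) ≤ E t X + E t Y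
  mul : ∀ t, ∀ l ∈ adaptedPart ℱ H t, ∀ Y ∈ H, l * Y ∈ H →
    E t (l * Y) = fun ω => max (l ω) 0 * E t Y ω + max (-l ω) 0 * E t (-Y) ω
  monotone_continuity : ∀ X : ℕ → Ω → ℝ, (∀ i, X i ∈ H) →
    (∀ ω, Antitone (fun i => X i ω) ∧ Tendsto (fun i => X i ω) atTop (𝓝 0)) →
    ∀ ω, Tendsto (fun i => E 0 (X i) ω) atTop (𝓝 0)

/-- The real number `ℰ(X)`: the value of the function `E 0 X`, which is constant when `ℱ 0` is
trivial (see `eq_expect`). -/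
noncomputable def expect [Nonempty Ω] (E : ℕ → (Ω → ℝ) → (Ω → ℝ)) (X : Ω → ℝ) : ℝ :=
  E 0 X (Classical.arbitrary Ω)

theorem eq_expect [mΩ : MeasurableSpace Ω] [Nonempty Ω] {ℱ : Filtration ℕ mΩ}
    {H : Submodule ℝ (Ω → ℝ)} {E : ℕ → (Ω → ℝ) → (Ω → ℝ)} (hE : IsSLExpectation ℱ H E)
    (h0 : ℱ 0 = ⊥) {X : Ω → ℝ} (hX : X ∈ H) (ω : Ω) : E 0 X ω = expect E X := by
  have h := (hE.mapsTo 0 X hX).2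
  rw [h0] at h
  have hs : MeasurableSet[⊥] (E 0 X ⁻¹' {E 0 X ω}) := h (measurableSet_singleton _)
  rcases MeasurableSpace.measurableSet_bot_iff.1 hs with h1 | h1
  · exact absurd (show ω ∈ E 0 X ⁻¹' {E 0 X ω} from rfl) (by rw [h1]; exact fun h => h)
  · have : Classical.arbitrary Ω ∈ E 0 X ⁻¹' {E 0 X ω} := by rw [h1]; trivial
    exact (show E 0 X (Classical.arbitrary Ω) = E 0 X ω from this).symm

/-- The upper capacity `𝕍(A) = ℰ(I_A)`. -/
noncomputable def capacity [Nonempty Ω] (E : ℕ → (Ω → ℝ) → (Ω → ℝ)) (A : Set Ω) : ℝ :=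
  expect E (A.indicator fun _ => 1)

/-- `P` holds quasi-surely: outside a measurable set of capacity zero. -/
def QuasiSurely [MeasurableSpace Ω] [Nonempty Ω] (E : ℕ → (Ω → ℝ) → (Ω → ℝ)) (P : Ω → Prop) :
    Prop :=
  ∃ N : Set Ω, MeasurableSet N ∧ capacity E N = 0 ∧ ∀ ω, ω ∉ N → P ω

/-- `X` is independent of `Y` under `ℰ`. -/
def IndepOf [Nonempty Ω] (H : Submodule ℝ (Ω → ℝ)) (E : ℕ → (Ω → ℝ) → (Ω → ℝ))
    (X Y : Ω → ℝ) : Prop :=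
  ∀ φ : ℝ × ℝ → ℝ, Measurable φ → (fun ω => φ (Y ω, X ω)) ∈ H →
    (∀ y : ℝ, (fun ω => φ (y, X ω)) ∈ H) →
    (fun ω => expect E (fun ω' => φ (Y ω, X ω'))) ∈ H ∧
      expect E (fun ω => φ (Y ω, X ω)) =
        expect E (fun ω => expect E (fun ω' => φ (Y ω, X ω')))

/-- `X` is independent of the σ-algebra `m`: it is independent of `I_A` for every `A` in `m`. -/
def IndepOfSigma [Nonempty Ω] (H : Submodule ℝ (Ω → ℝ)) (E : ℕ → (Ω → ℝ) → (Ω → ℝ))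
    (X : Ω → ℝ) (m : MeasurableSpace Ω) : Prop :=
  ∀ A : Set Ω, MeasurableSet[m] A → IndepOf H E X (A.indicator fun _ => 1)

/-- `X` and `Y` are identically distributed under `ℰ`. -/
def SameLaw [Nonempty Ω] (H : Submodule ℝ (Ω → ℝ)) (E : ℕ → (Ω → ℝ) → (Ω → ℝ))
    (X Y : Ω → ℝ) : Prop :=
  ∀ φ : ℝ → ℝ, Measurable φ → (fun ω => φ (X ω)) ∈ H → (fun ω => φ (Y ω)) ∈ H →
    expect E (fun ω => φ (X ω)) = expect E (fun ω => φ (Y ω))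

/-- Assumption (A): for every sequence `Y 1, Y 2, …` in `H`, each event of `σ(Y k, k ≥ 1)` is a
limit in capacity of events `B n` of `σ(Y 1, …, Y n)`. (The term `Y 0` plays no role.) -/
def AssumptionA [Nonempty Ω] (H : Submodule ℝ (Ω → ℝ)) (E : ℕ → (Ω → ℝ) → (Ω → ℝ)) : Prop :=
  ∀ Y : ℕ → Ω → ℝ, (∀ n, 1 ≤ n → Y n ∈ H) →
    ∀ B : Set Ω, MeasurableSet[⨆ k, ⨆ _ : 1 ≤ k, (borel ℝ).comap (Y k)] B →
      ∃ Bn : ℕ → Set Ω,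
        (∀ n, 1 ≤ n → MeasurableSet[⨆ k ∈ Finset.Icc 1 n, (borel ℝ).comap (Y k)] (Bn n)) ∧
        Tendsto (fun n => capacity E ((Bn n \ B) ∪ (B \ Bn n))) atTop (𝓝 0)

end SublinearLLN

/-!
The averages of an independent, identically distributed sequence under a sublinear expectation `ℰ`
obey two one-sided laws, one for `X` and one for `-X`; each part of the theorem combines them.

Quasi-sure statements are handled through the outer measure generated by the upper capacity
(`capacityOuter`), whose almost-everywhere filter is quasi-sureness (`IsSLSpace.quasiSurely_iff`).
Monotone continuity gives the countable subadditivity of the capacity and the uniform integrability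
of each element of `H`. Independence of the past says that quasi-surely the conditional expectation
of `f (X (k + 1))` at time `k` is `ℰ(f (X (k + 1)))` (`IsSLSpace.condExpect_comp_ae_eq`).

For the strong law it suffices that `limsup S_n / n ≤ ℰ(X 1)`. The space `H` need not contain
`X ^ 2`, even for bounded `X`, so the variables are truncated and rounded up to finitely many values
(`roundTrunc`); the rounding error `1 / i` of the `i`-th term disappears in the averages. The
centered truncations have conditional expectation zero, but the square of their sum `T` is not
controlled, because `ℰ` is only positively homogeneous. The square of `T⁺` is, as
`(T + U)⁺ ^ 2 ≤ T⁺ ^ 2 + 2 * T⁺ * U + U ^ 2`, and a Hájek–Rényi inequality for `(T⁺ / k) ^ 2`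
(`IsSLSpace.capacity_exists_lt_sum_le`) bounds the upper limit of `T / k`. The summability
assumption provides the second moments and, by Borel–Cantelli, the removal of the truncation
(`IsSLSpace.ae_eventually_average_le_expect`).

For the converse, let `S_n / n` converge to `Z`. The averages are uniformly integrable, so that
`ℰ(I_A (Z - c)) ≥ (ℰ(X 1) - c) 𝕍(A)` for `c ≤ ℰ(X 1)` and events `A` known at a finite time
(`IsSLSpace.mul_capacity_le_expect_indicator`). Assumption (A) extends this to the event
`{S_n / n < c eventually}`, where the left side is nonpositive. Hence `Z ≥ ℰ(X 1)` quasi-surely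
(`IsSLSpace.ae_expect_le_of_tendsto_average`), and the same bound for `-X` gives
`Z ≤ -ℰ(-X 1) ≤ ℰ(X 1)`.
-/

namespace SublinearLLN

/-! ### The space of random variables -/

namespace IsRandomVariableSpace

variable {Ω : Type*} [MeasurableSpace Ω] {H : Submodule ℝ (Ω → ℝ)}

theorem indicator_const_mem (hH : IsRandomVariableSpace H) {A : Set Ω} (hA : MeasurableSet A)
    (c : ℝ) : A.indicator (fun _ => c) ∈ H :=
  hH.indicator_mem _ (hH.const_mem c) A hA

/-- `H` need not be closed under products, but it contains all measurable functions with finitely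
many values, and these are. -/
theorem mem_of_finite_range (hH : IsRandomVariableSpace H) {X : Ω → ℝ} (hX : Measurable X)
    (hfin : (Set.range X).Finite) : X ∈ H := by
  have key : ∀ f : SimpleFunc Ω ℝ, (f : Ω → ℝ) ∈ H := by
    intro f
    induction f using SimpleFunc.induction with
    | const c hs =>
      convert hH.indicator_const_mem hs c using 1
      ext ω
      simp [Set.indicator, Set.piecewise]
    | add _ hf hg => exact H.add_mem hf hg
  exact key ⟨X, fun c => hX (measurableSet_singleton c), hfin⟩

end IsRandomVariableSpace

/-- A function with finitely many values that is measurable for the σ-algebra `m`. -/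
def IsSimple {Ω : Type*} (m : MeasurableSpace Ω) (X : Ω → ℝ) : Prop :=
  Measurable[m] X ∧ (Set.range X).Finite

namespace IsSimple

variable {Ω : Type*} {m : MeasurableSpace Ω} {X Y : Ω → ℝ}

theorem comp₂ (hX : IsSimple m X) (hY : IsSimple m Y) {φ : ℝ → ℝ → ℝ}
    (hφ : Measurable (Function.uncurry φ)) : IsSimple m fun ω => φ (X ω) (Y ω) := by
  refine ⟨hφ.comp (hX.1.prodMk hY.1), (hX.2.image2 φ hY.2).subset ?_⟩
  rintro _ ⟨ω, rfl⟩
  exact ⟨_, ⟨ω, rfl⟩, _, ⟨ω, rfl⟩, rfl⟩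

theorem comp (hX : IsSimple m X) {φ : ℝ → ℝ} (hφ : Measurable φ) :
    IsSimple m fun ω => φ (X ω) := by
  refine ⟨hφ.comp hX.1, (hX.2.image φ).subset ?_⟩
  rintro _ ⟨ω, rfl⟩
  exact ⟨_, ⟨ω, rfl⟩, rfl⟩

theorem const (c : ℝ) : IsSimple m fun _ => c := by
  refine ⟨measurable_const, (Set.finite_singleton c).subset ?_⟩
  rintro _ ⟨_, rfl⟩
  rfl

theorem add (hX : IsSimple m X) (hY : IsSimple m Y) : IsSimple m fun ω => X ω + Y ω :=
  hX.comp₂ hY (φ := fun x y => x + y) (by fun_prop)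

theorem mul (hX : IsSimple m X) (hY : IsSimple m Y) : IsSimple m fun ω => X ω * Y ω :=
  hX.comp₂ hY (φ := fun x y => x * y) (by fun_prop)

theorem indicator (hX : IsSimple m X) {A : Set Ω} (hA : MeasurableSet[m] A) :
    IsSimple m (A.indicator X) := by
  refine ⟨hX.1.indicator hA, (hX.2.union (Set.finite_singleton 0)).subset ?_⟩
  rintro _ ⟨ω, rfl⟩
  by_cases h : ω ∈ A <;> simp [h]

theorem sum {ι : Type*} {s : Finset ι} {f : ι → Ω → ℝ} (hf : ∀ i ∈ s, IsSimple m (f i)) :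
    IsSimple m fun ω => ∑ i ∈ s, f i ω := by
  classical
  induction s using Finset.induction_on with
  | empty => simpa using const 0
  | insert a s ha ih =>
    simp only [Finset.sum_insert ha]
    exact (hf a (by simp)).add (ih fun i hi => hf i (by simp [hi]))

theorem mono {m' : MeasurableSpace Ω} (hX : IsSimple m X) (h : m ≤ m') : IsSimple m' X :=
  ⟨hX.1.mono h le_rfl, hX.2⟩

end IsSimple

/-! ### Elementary properties of a sublinear expectation -/

/-- The standing assumptions: a space `H` of random variables, an `𝒮ℒ`-expectation on it, and a
trivial initial σ-algebra. -/
structure IsSLSpace {Ω : Type*} [mΩ : MeasurableSpace Ω] (ℱ : Filtration ℕ mΩ)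
    (H : Submodule ℝ (Ω → ℝ)) (E : ℕ → (Ω → ℝ) → (Ω → ℝ)) : Prop where
  isSpace : IsRandomVariableSpace H
  isSL : IsSLExpectation ℱ H E
  zero : ℱ 0 = ⊥

namespace IsSLSpace

section CondExpect

variable {Ω : Type*} [mΩ : MeasurableSpace Ω] {ℱ : Filtration ℕ mΩ}
  {H : Submodule ℝ (Ω → ℝ)} {E : ℕ → (Ω → ℝ) → (Ω → ℝ)} {X Y : Ω → ℝ}

theorem adapted_of_isSimple (h : IsSLSpace ℱ H E) {k : ℕ} (hX : IsSimple (ℱ k) X) :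
    X ∈ adaptedPart ℱ H k :=
  ⟨h.isSpace.mem_of_finite_range (hX.mono (ℱ.le k)).1 hX.2, hX.1⟩

theorem indicator_mem_adaptedPart (h : IsSLSpace ℱ H E) {k : ℕ} {Y : Ω → ℝ}
    (hY : Y ∈ adaptedPart ℱ H k) {A : Set Ω} (hA : MeasurableSet[ℱ k] A) :
    A.indicator Y ∈ adaptedPart ℱ H k :=
  ⟨h.isSpace.indicator_mem _ hY.1 A (ℱ.le k A hA), hY.2.indicator hA⟩

theorem condExpect_mem (h : IsSLSpace ℱ H E) (k : ℕ) (hX : X ∈ H) : E k X ∈ H :=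
  (h.isSL.mapsTo k X hX).1

/-- Random variables known at time `k` can be taken out of a sum under `E k`. -/
theorem condExpect_add (h : IsSLSpace ℱ H E) {k : ℕ} (hX : X ∈ H) (hY : Y ∈ adaptedPart ℱ H k) :
    E k (Y + X) = Y + E k X := by
  have hYn : -Y ∈ adaptedPart ℱ H k := ⟨H.neg_mem hY.1, hY.2.neg⟩
  apply le_antisymm
  · have h1 := h.isSL.subadd k Y hY.1 X hX
    rwa [h.isSL.eq_self k Y hY] at h1
  · have h1 := h.isSL.subadd k (-Y) hYn.1 (Y + X) (H.add_mem hY.1 hX)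
    rw [h.isSL.eq_self k _ hYn, neg_add_cancel_left] at h1
    intro ω
    have h2 := h1 ω
    simp only [Pi.add_apply, Pi.neg_apply] at h2 ⊢
    linarith

theorem condExpect_mul (h : IsSLSpace ℱ H E) {k : ℕ} {l Y : Ω → ℝ}
    (hl : l ∈ adaptedPart ℱ H k) (hl0 : ∀ ω, 0 ≤ l ω) (hY : Y ∈ H)
    (hlY : (fun ω => l ω * Y ω) ∈ H) (ω : Ω) :
    E k (fun ω => l ω * Y ω) ω = l ω * E k Y ω := by
  have h1 := congrFun (h.isSL.mul k l hl Y hY hlY) ω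
  simp only [max_eq_left (hl0 ω), max_eq_right (neg_nonpos.2 (hl0 ω)), zero_mul, add_zero] at h1
  exact h1

end CondExpect

variable {Ω : Type*} [mΩ : MeasurableSpace Ω] [Nonempty Ω] {ℱ : Filtration ℕ mΩ}
  {H : Submodule ℝ (Ω → ℝ)} {E : ℕ → (Ω → ℝ) → (Ω → ℝ)} {X Y Z : Ω → ℝ} {A B : Set Ω}

theorem expect_mono (h : IsSLSpace ℱ H E) (hX : X ∈ H) (hY : Y ∈ H) (hXY : ∀ ω, X ω ≤ Y ω) :
    expect E X ≤ expect E Y :=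
  h.isSL.mono 0 Y hY X hX hXY _

theorem expect_add_le (h : IsSLSpace ℱ H E) (hX : X ∈ H) (hY : Y ∈ H) :
    expect E (fun ω => X ω + Y ω) ≤ expect E X + expect E Y :=
  h.isSL.subadd 0 X hX Y hY _

theorem expect_const (h : IsSLSpace ℱ H E) (c : ℝ) : expect E (fun _ => c) = c :=
  congrFun (h.isSL.eq_self 0 _ ⟨h.isSpace.const_mem c, measurable_const⟩) _

theorem expect_smul (h : IsSLSpace ℱ H E) {c : ℝ} (hc : 0 ≤ c) (hX : X ∈ H) :
    expect E (fun ω => c * X ω) = c * expect E X := by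
  have h1 := congrFun (h.isSL.mul 0 (fun _ => c) ⟨h.isSpace.const_mem c, measurable_const⟩ X hX
    (H.smul_mem c hX)) (Classical.arbitrary Ω)
  simp only [max_eq_left hc, max_eq_right (neg_nonpos.2 hc), zero_mul, add_zero] at h1
  exact h1

theorem expect_tower (h : IsSLSpace ℱ H E) (k : ℕ) (hX : X ∈ H) :
    expect E X = expect E (E k X) :=
  congrFun (h.isSL.tower 0 k (Nat.zero_le k) X hX) _

theorem expect_const_add (h : IsSLSpace ℱ H E) (hX : X ∈ H) (c : ℝ) :
    expect E (fun ω => c + X ω) = c + expect E X :=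
  congrFun (h.condExpect_add (k := 0) hX (Y := fun _ => c)
    ⟨h.isSpace.const_mem c, measurable_const⟩) _

theorem neg_expect_neg_le (h : IsSLSpace ℱ H E) (hX : X ∈ H) :
    -expect E (-X) ≤ expect E X := by
  have h1 := h.expect_add_le hX (H.neg_mem hX)
  simp only [Pi.neg_apply, add_neg_cancel, h.expect_const] at h1
  linarith

theorem expect_sum_le (h : IsSLSpace ℱ H E) {ι : Type*} {s : Finset ι} {f : ι → Ω → ℝ}
    (hf : ∀ i ∈ s, f i ∈ H) :
    expect E (fun ω => ∑ i ∈ s, f i ω) ≤ ∑ i ∈ s, expect E (f i) := by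
  classical
  induction s using Finset.induction_on with
  | empty => simp [h.expect_const]
  | insert a s ha ih =>
    simp only [Finset.sum_insert ha]
    have hs : (fun ω => ∑ i ∈ s, f i ω) ∈ H := by
      have := H.sum_mem (t := s) (f := f) fun i hi => hf i (by simp [hi])
      convert this using 1
      ext ω
      simp
    exact (h.expect_add_le (hf a (by simp)) hs).trans
      (by grw [ih fun i hi => hf i (by simp [hi])])

theorem expect_nonneg (h : IsSLSpace ℱ H E) (hX : X ∈ H) (h0 : ∀ ω, 0 ≤ X ω) :
    0 ≤ expect E X :=
  (h.expect_const 0).symm.le.trans (h.expect_mono (h.isSpace.const_mem 0) hX h0)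

theorem expect_le_add_expect_abs_sub (h : IsSLSpace ℱ H E) (hX : X ∈ H) (hY : Y ∈ H) :
    expect E X ≤ expect E Y + expect E (fun ω => |X ω - Y ω|) := by
  have hd := h.isSpace.abs_mem _ (H.sub_mem hX hY)
  refine le_trans (h.expect_mono hX (H.add_mem hY hd) fun ω => ?_) (h.expect_add_le hY hd)
  have := le_abs_self (X ω - Y ω)
  simp only [Pi.add_apply, Pi.sub_apply]
  linarith

/-! ### The upper capacity -/

theorem capacity_mono (h : IsSLSpace ℱ H E) (hA : MeasurableSet A) (hB : MeasurableSet B)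
    (hAB : A ⊆ B) : capacity E A ≤ capacity E B :=
  h.expect_mono (h.isSpace.indicator_const_mem hA 1) (h.isSpace.indicator_const_mem hB 1)
    (Set.indicator_le_indicator_of_subset hAB fun _ => zero_le_one)

theorem capacity_nonneg (h : IsSLSpace ℱ H E) (hA : MeasurableSet A) : 0 ≤ capacity E A :=
  h.expect_nonneg (h.isSpace.indicator_const_mem hA 1)
    (Set.indicator_nonneg fun _ _ => zero_le_one)

theorem capacity_empty (h : IsSLSpace ℱ H E) : capacity E ∅ = 0 := by
  simpa [capacity] using h.expect_const 0

theorem capacity_univ (h : IsSLSpace ℱ H E) : capacity E Set.univ = 1 := by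
  simpa [capacity] using h.expect_const 1

theorem capacity_union_le (h : IsSLSpace ℱ H E) (hA : MeasurableSet A) (hB : MeasurableSet B) :
    capacity E (A ∪ B) ≤ capacity E A + capacity E B := by
  have h1 := h.isSpace.indicator_const_mem hA 1
  have h2 := h.isSpace.indicator_const_mem hB 1
  refine le_trans (h.expect_mono (h.isSpace.indicator_const_mem (hA.union hB) 1)
    (H.add_mem h1 h2) fun ω => ?_) (h.expect_add_le h1 h2)
  by_cases ha : ω ∈ A <;> by_cases hb : ω ∈ B <;> simp [ha, hb]

theorem expect_indicator_const (h : IsSLSpace ℱ H E) (hA : MeasurableSet A) {c : ℝ} (hc : 0 ≤ c) :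
    expect E (A.indicator fun _ => c) = c * capacity E A := by
  rw [capacity, ← h.expect_smul hc (h.isSpace.indicator_const_mem hA 1)]
  congr 1
  ext ω
  by_cases ha : ω ∈ A <;> simp [ha]

/-- Continuity of the capacity from above at the empty set, a form of monotone continuity. -/
theorem tendsto_capacity_of_antitone (h : IsSLSpace ℱ H E) {D : ℕ → Set Ω}
    (hD : ∀ n, MeasurableSet (D n)) (hanti : Antitone D) (hempty : ∀ ω, ∃ n, ω ∉ D n) :
    Tendsto (fun n => capacity E (D n)) atTop (𝓝 0) := by
  refine h.isSL.monotone_continuity (fun n => (D n).indicator fun _ => 1)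
    (fun n => h.isSpace.indicator_const_mem (hD n) 1) (fun ω => ⟨fun n m hnm => ?_, ?_⟩) _
  · exact Set.indicator_le_indicator_of_subset (hanti hnm) (fun _ => zero_le_one) ω
  · obtain ⟨n, hn⟩ := hempty ω
    refine tendsto_const_nhds.congr' ?_
    filter_upwards [eventually_ge_atTop n] with m hm
    exact (Set.indicator_of_notMem (fun h' => hn (hanti hm h')) _).symm

theorem capacity_biUnion_le (h : IsSLSpace ℱ H E) {f : ℕ → Set Ω} (hf : ∀ n, MeasurableSet (f n))
    (n : ℕ) : capacity E (⋃ i ∈ Finset.range n, f i) ≤ ∑ i ∈ Finset.range n, capacity E (f i) := by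
  induction n with
  | zero => simp [h.capacity_empty]
  | succ n ih =>
    rw [Finset.sum_range_succ, Finset.range_add_one, Finset.set_biUnion_insert, Set.union_comm]
    grw [h.capacity_union_le (Finset.measurableSet_biUnion _ fun i _ => hf i) (hf n), ih]

/-- Countable subadditivity. The remainders after `n` sets decrease to the empty set, so that it
follows from finite subadditivity. -/
theorem ofReal_capacity_iUnion_le (h : IsSLSpace ℱ H E) {f : ℕ → Set Ω}
    (hf : ∀ n, MeasurableSet (f n)) :
    ENNReal.ofReal (capacity E (⋃ i, f i)) ≤ ∑' i, ENNReal.ofReal (capacity E (f i)) := by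
  set U : ℕ → Set Ω := fun n => ⋃ i ∈ Finset.range n, f i with hU
  have hUm : ∀ n, MeasurableSet (U n) := fun n => Finset.measurableSet_biUnion _ fun i _ => hf i
  have hlim := h.tendsto_capacity_of_antitone (D := fun n => (⋃ i, f i) \ U n)
    (fun n => (MeasurableSet.iUnion hf).diff (hUm n))
    (fun n m hnm => Set.sdiff_subset_sdiff_right
      (Set.biUnion_subset_biUnion_left fun i hi => by
        simp only [Finset.coe_range, Set.mem_Iio] at hi ⊢
        exact lt_of_lt_of_le hi hnm))
    (fun ω => by
      by_cases hω : ω ∈ ⋃ i, f i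
      · obtain ⟨i, hi⟩ := Set.mem_iUnion.1 hω
        refine ⟨i + 1, fun h' => h'.2 ?_⟩
        exact Set.mem_biUnion (show i ∈ ((Finset.range (i + 1) : Finset ℕ)) by simp) hi
      · exact ⟨0, fun h' => hω h'.1⟩)
  have hlim2 := (ENNReal.tendsto_ofReal hlim).add_const (∑' i, ENNReal.ofReal (capacity E (f i)))
  rw [ENNReal.ofReal_zero, zero_add] at hlim2
  refine ge_of_tendsto' hlim2 fun n => ?_
  have hsub : (⋃ i, f i) ⊆ ((⋃ i, f i) \ U n) ∪ U n := by
    intro ω hω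
    by_cases hn : ω ∈ U n
    · exact Or.inr hn
    · exact Or.inl ⟨hω, hn⟩
  have hd := (MeasurableSet.iUnion hf).diff (hUm n)
  calc ENNReal.ofReal (capacity E (⋃ i, f i))
      ≤ ENNReal.ofReal (capacity E ((⋃ i, f i) \ U n)
          + ∑ i ∈ Finset.range n, capacity E (f i)) := by
        apply ENNReal.ofReal_le_ofReal
        grw [h.capacity_mono (MeasurableSet.iUnion hf) (hd.union (hUm n)) hsub,
          h.capacity_union_le hd (hUm n), h.capacity_biUnion_le hf n]
    _ = ENNReal.ofReal (capacity E ((⋃ i, f i) \ U n))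
          + ∑ i ∈ Finset.range n, ENNReal.ofReal (capacity E (f i)) := by
        rw [ENNReal.ofReal_add (h.capacity_nonneg hd)
          (Finset.sum_nonneg fun i _ => h.capacity_nonneg (hf i)),
          ENNReal.ofReal_sum_of_nonneg fun i _ => h.capacity_nonneg (hf i)]
    _ ≤ _ := by grw [ENNReal.sum_le_tsum]

end IsSLSpace

/-- The outer measure generated by the upper capacity. It agrees with the capacity on measurable
sets (`IsSLSpace.capacityOuter_apply`), and its null sets are the sets that are negligible
quasi-surely, so that the almost-everywhere filter is available for quasi-sure statements. -/
noncomputable def capacityOuter {Ω : Type*} [MeasurableSpace Ω] [Nonempty Ω]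
    (E : ℕ → (Ω → ℝ) → (Ω → ℝ)) : OuterMeasure Ω :=
  OuterMeasure.boundedBy
    (extend fun (s : Set Ω) (_ : MeasurableSet s) => ENNReal.ofReal (capacity E s))

namespace IsSLSpace

variable {Ω : Type*} [mΩ : MeasurableSpace Ω] [Nonempty Ω] {ℱ : Filtration ℕ mΩ}
  {H : Submodule ℝ (Ω → ℝ)} {E : ℕ → (Ω → ℝ) → (Ω → ℝ)} {X Y Z : Ω → ℝ} {A B : Set Ω}

theorem capacityOuter_eq_iInf (h : IsSLSpace ℱ H E) (s : Set Ω) :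
    capacityOuter E s =
      ⨅ (t : Set Ω) (_ : MeasurableSet t) (_ : s ⊆ t), ENNReal.ofReal (capacity E t) := by
  have h0 : ENNReal.ofReal (capacity E (∅ : Set Ω)) = 0 := by rw [h.capacity_empty]; simp
  have h1 : capacityOuter E s = inducedOuterMeasure
      (fun (s : Set Ω) (_ : MeasurableSet s) => ENNReal.ofReal (capacity E s))
      MeasurableSet.empty h0 s := OuterMeasure.boundedBy_eq_ofFunction _ _
  rw [h1]
  exact inducedOuterMeasure_eq_iInf (fun _ hf => MeasurableSet.iUnion hf)
    (fun f hf => h.ofReal_capacity_iUnion_le hf)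
    (fun s t hs ht hst => ENNReal.ofReal_le_ofReal (h.capacity_mono hs ht hst)) s

theorem capacityOuter_apply (h : IsSLSpace ℱ H E) (hA : MeasurableSet A) :
    capacityOuter E A = ENNReal.ofReal (capacity E A) := by
  rw [h.capacityOuter_eq_iInf]
  apply le_antisymm
  · exact iInf_le_of_le A (iInf_le_of_le hA (iInf_le _ subset_rfl))
  · exact le_iInf fun t => le_iInf fun ht => le_iInf fun hAt =>
      ENNReal.ofReal_le_ofReal (h.capacity_mono hA ht hAt)

theorem capacityOuter_eq_zero_iff (h : IsSLSpace ℱ H E) (hA : MeasurableSet A) :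
    capacityOuter E A = 0 ↔ capacity E A = 0 := by
  rw [h.capacityOuter_apply hA, ENNReal.ofReal_eq_zero]
  exact ⟨fun h1 => le_antisymm h1 (h.capacity_nonneg hA), fun h1 => h1.le⟩

theorem quasiSurely_iff (h : IsSLSpace ℱ H E) {P : Ω → Prop} :
    QuasiSurely E P ↔ ∀ᵐ ω ∂(capacityOuter E), P ω := by
  rw [ae_iff]
  constructor
  · rintro ⟨N, hN, hN0, hP⟩
    refine measure_mono_null (fun ω hω => ?_) ((h.capacityOuter_eq_zero_iff hN).2 hN0)
    by_contra hωN
    exact hω (hP ω hωN)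
  · intro h0
    have hex : ∀ n : ℕ, ∃ t : Set Ω, MeasurableSet t ∧ {ω | ¬P ω} ⊆ t ∧
        ENNReal.ofReal (capacity E t) < ((n : ENNReal) + 1)⁻¹ := by
      intro n
      have hlt : capacityOuter E {ω | ¬P ω} < ((n : ENNReal) + 1)⁻¹ := by
        rw [h0]; simp
      rw [h.capacityOuter_eq_iInf] at hlt
      simp only [iInf_lt_iff] at hlt
      obtain ⟨t, ht, hs, hlt⟩ := hlt
      exact ⟨t, ht, hs, hlt⟩
    choose t htm hts htlt using hex
    have hm := MeasurableSet.iInter htm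
    refine ⟨⋂ n, t n, hm, (h.capacityOuter_eq_zero_iff hm).1 ?_, fun ω hω => ?_⟩
    · have hlim : Tendsto (fun n : ℕ => ((n : ENNReal) + 1)⁻¹) atTop (𝓝 0) := by
        have := (tendsto_add_atTop_iff_nat 1).2 ENNReal.tendsto_inv_nat_nhds_zero
        simpa using this
      refine le_antisymm (ge_of_tendsto' hlim fun n => ?_) zero_le
      exact (measure_mono (Set.iInter_subset t n)).trans
        ((h.capacityOuter_apply (htm n)).trans_le (htlt n).le)
    · by_contra hP
      exact hω (Set.mem_iInter.2 fun n => hts n hP)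

/-- A property holds quasi-surely if it fails only inside measurable sets of arbitrarily small
capacity. -/
theorem ae_of_forall_capacity_le (h : IsSLSpace ℱ H E) {P : Ω → Prop}
    (hP : ∀ ε > 0, ∃ A : Set Ω, MeasurableSet A ∧ capacity E A ≤ ε ∧ ∀ ω, ω ∉ A → P ω) :
    ∀ᵐ ω ∂(capacityOuter E), P ω := by
  rw [ae_iff]
  refine le_antisymm (ENNReal.le_of_forall_pos_le_add fun ε hε _ => ?_) zero_le
  obtain ⟨A, hA, hAε, hAP⟩ := hP ε hε
  rw [zero_add]
  calc capacityOuter E {ω | ¬P ω} ≤ capacityOuter E A := measure_mono fun ω hω => by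
        by_contra hωA
        exact hω (hAP ω hωA)
    _ ≤ ENNReal.ofReal ε := by
        rw [h.capacityOuter_apply hA]
        exact ENNReal.ofReal_le_ofReal hAε
    _ = ε := by simp

/-! ### Absolute continuity and quasi-sure inequalities -/

/-- Every element of `H` is uniformly integrable by itself. -/
theorem tendsto_expect_tail (h : IsSLSpace ℱ H E) (hZ : Z ∈ H) :
    Tendsto (fun n : ℕ => expect E ({ω | (n : ℝ) < |Z ω|}.indicator fun ω => |Z ω|)) atTop
      (𝓝 0) := by
  have hm : ∀ n : ℕ, MeasurableSet {ω | (n : ℝ) < |Z ω|} := fun n =>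
    measurableSet_lt measurable_const (h.isSpace.measurable _ (h.isSpace.abs_mem Z hZ))
  refine h.isSL.monotone_continuity (fun n : ℕ => {ω | (n : ℝ) < |Z ω|}.indicator fun ω => |Z ω|)
    (fun n => h.isSpace.indicator_mem _ (h.isSpace.abs_mem Z hZ) _ (hm n))
    (fun ω => ⟨fun n m hnm => ?_, ?_⟩) _
  · refine Set.indicator_le_indicator_of_subset (fun ω hω => ?_) (fun _ => abs_nonneg _) ω
    have h1 : (m : ℝ) < |Z ω| := hω
    exact lt_of_le_of_lt (Nat.cast_le.2 hnm) h1
  · obtain ⟨n, hn⟩ := exists_nat_ge |Z ω|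
    refine tendsto_const_nhds.congr' ?_
    filter_upwards [eventually_ge_atTop n] with m hm
    refine (Set.indicator_of_notMem (fun h' => ?_) _).symm
    have h1 : (m : ℝ) < |Z ω| := h'
    have h2 : (n : ℝ) ≤ m := Nat.cast_le.2 hm
    linarith

/-- Absolute continuity of the expectation with respect to the capacity. -/
theorem tendsto_expect_indicator (h : IsSLSpace ℱ H E) (hZ : Z ∈ H) {G : ℕ → Set Ω}
    (hG : ∀ n, MeasurableSet (G n)) (hG0 : Tendsto (fun n => capacity E (G n)) atTop (𝓝 0)) :
    Tendsto (fun n => expect E ((G n).indicator fun ω => |Z ω|)) atTop (𝓝 0) := by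
  have hZa := h.isSpace.abs_mem Z hZ
  have hZm := h.isSpace.measurable _ hZa
  have hbound : ∀ L n : ℕ, expect E ((G n).indicator fun ω => |Z ω|) ≤
      L * capacity E (G n) + expect E ({ω | (L : ℝ) < |Z ω|}.indicator fun ω => |Z ω|) := by
    intro L n
    have hL : MeasurableSet {ω | (L : ℝ) < |Z ω|} := measurableSet_lt measurable_const hZm
    have h1 := h.isSpace.indicator_const_mem (hG n) (L : ℝ)
    have h2 := h.isSpace.indicator_mem _ hZa _ hL
    rw [← h.expect_indicator_const (hG n) (Nat.cast_nonneg L)]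
    refine le_trans (h.expect_mono (h.isSpace.indicator_mem _ hZa _ (hG n)) (H.add_mem h1 h2)
      fun ω => ?_) (h.expect_add_le h1 h2)
    have h0 := abs_nonneg (Z ω)
    have hL0 : (0 : ℝ) ≤ L := Nat.cast_nonneg L
    by_cases ha : ω ∈ G n <;> by_cases hb : (L : ℝ) < |Z ω| <;>
      (simp [ha, hb, Set.indicator]; try linarith)
  rw [Metric.tendsto_atTop]
  intro ε hε
  obtain ⟨L, hL⟩ := ((h.tendsto_expect_tail hZ).eventually_lt_const (half_pos hε)).exists
  have h3 : Tendsto (fun n => (L : ℝ) * capacity E (G n)) atTop (𝓝 0) := by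
    simpa using hG0.const_mul (L : ℝ)
  obtain ⟨N, hN⟩ := eventually_atTop.1 (h3.eventually_lt_const (half_pos hε))
  refine ⟨N, fun n hn => ?_⟩
  have h4 : 0 ≤ expect E ((G n).indicator fun ω => |Z ω|) :=
    h.expect_nonneg (h.isSpace.indicator_mem _ hZa _ (hG n))
      (Set.indicator_nonneg fun _ _ => abs_nonneg _)
  rw [Real.dist_eq, sub_zero, abs_of_nonneg h4]
  linarith [hN n hn, hbound L n]

theorem expect_le_of_ae (h : IsSLSpace ℱ H E) (hX : X ∈ H) (hY : Y ∈ H)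
    (hXY : ∀ᵐ ω ∂(capacityOuter E), X ω ≤ Y ω) : expect E X ≤ expect E Y := by
  obtain ⟨N, hN, hN0, hNP⟩ := h.quasiSurely_iff.2 hXY
  have hd : X - Y ∈ H := H.sub_mem hX hY
  have h0 : expect E (N.indicator fun ω => |(X - Y) ω|) = 0 :=
    tendsto_nhds_unique tendsto_const_nhds
      (h.tendsto_expect_indicator hd (G := fun _ => N) (fun _ => hN) (by simp [hN0]))
  have hi := h.isSpace.indicator_mem _ (h.isSpace.abs_mem _ hd) _ hN
  rw [← add_zero (expect E Y), ← h0]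
  refine le_trans (h.expect_mono hX (H.add_mem hY hi) fun ω => ?_) (h.expect_add_le hY hi)
  by_cases hω : ω ∈ N
  · have := le_abs_self (X ω - Y ω)
    simp only [Pi.add_apply, Set.indicator_of_mem hω, Pi.sub_apply]
    linarith
  · simpa [hω] using hNP ω hω

/-- Quasi-sure convergence implies convergence in capacity. -/
theorem tendsto_capacity_of_ae (h : IsSLSpace ℱ H E) {f : ℕ → Ω → ℝ} (hf : ∀ n, f n ∈ H)
    (hZ : Z ∈ H) (hlim : ∀ᵐ ω ∂(capacityOuter E), Tendsto (fun n => f n ω) atTop (𝓝 (Z ω)))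
    {ε : ℝ} (hε : 0 < ε) :
    Tendsto (fun n => capacity E {ω | ε < |f n ω - Z ω|}) atTop (𝓝 0) := by
  obtain ⟨N, hN, hN0, hNP⟩ := h.quasiSurely_iff.2 hlim
  have hGm : ∀ n, MeasurableSet {ω | ε < |f n ω - Z ω|} := fun n =>
    measurableSet_lt measurable_const
      (h.isSpace.measurable _ (h.isSpace.abs_mem _ (H.sub_mem (hf n) hZ)))
  set D : ℕ → Set Ω := fun m => (⋃ n, ⋃ _ : m ≤ n, {ω | ε < |f n ω - Z ω|}) \ N with hD
  have hDm : ∀ m, MeasurableSet (D m) := fun m =>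
    (MeasurableSet.iUnion fun n => MeasurableSet.iUnion fun _ => hGm n).diff hN
  have hD0 := h.tendsto_capacity_of_antitone hDm
    (fun m m' hmm => by
      rintro ω ⟨hω, hωN⟩
      simp only [Set.mem_iUnion] at hω
      obtain ⟨n, hn, hω⟩ := hω
      exact ⟨Set.mem_iUnion.2 ⟨n, Set.mem_iUnion.2 ⟨hmm.trans hn, hω⟩⟩, hωN⟩)
    (fun ω => by
      by_cases hω : ω ∈ N
      · exact ⟨0, fun h' => h'.2 hω⟩
      · obtain ⟨m, hm⟩ := Metric.tendsto_atTop.1 (hNP ω hω) ε hε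
        refine ⟨m, fun h' => ?_⟩
        have h1 := h'.1
        simp only [Set.mem_iUnion] at h1
        obtain ⟨n, hn, h2⟩ := h1
        have h3 := hm n hn
        rw [Real.dist_eq] at h3
        exact absurd h3 (not_lt.2 (le_of_lt h2)))
  refine squeeze_zero (fun n => h.capacity_nonneg (hGm n)) (fun n => ?_) hD0
  calc capacity E {ω | ε < |f n ω - Z ω|} ≤ capacity E (D n ∪ N) := by
        refine h.capacity_mono (hGm n) ((hDm n).union hN) fun ω hω => ?_
        by_cases hωN : ω ∈ N
        · exact Or.inr hωN
        · exact Or.inl ⟨Set.mem_iUnion.2 ⟨n, Set.mem_iUnion.2 ⟨le_rfl, hω⟩⟩, hωN⟩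
    _ ≤ capacity E (D n) := by
        have := h.capacity_union_le (hDm n) hN
        rw [hN0] at this
        linarith

end IsSLSpace

/-! ### Independent, identically distributed sequences -/

/-- `X 1, X 2, …` is adapted, each term is independent of the past and distributed like `X 1`.
The term `X 0` plays no role. -/
structure IsIIDAdapted {Ω : Type*} [mΩ : MeasurableSpace Ω] [Nonempty Ω] (ℱ : Filtration ℕ mΩ)
    (H : Submodule ℝ (Ω → ℝ)) (E : ℕ → (Ω → ℝ) → (Ω → ℝ)) (X : ℕ → Ω → ℝ) : Prop where
  adapted : ∀ i, 1 ≤ i → X i ∈ adaptedPart ℱ H i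
  indep : ∀ i, 1 ≤ i → IndepOfSigma H E (X i) (ℱ (i - 1))
  law : ∀ i, 1 ≤ i → SameLaw H E (X i) (X 1)

section

variable {Ω : Type*} [mΩ : MeasurableSpace Ω] [Nonempty Ω] {ℱ : Filtration ℕ mΩ}
  {H : Submodule ℝ (Ω → ℝ)} {E : ℕ → (Ω → ℝ) → (Ω → ℝ)}

theorem IsIIDAdapted.neg {X : ℕ → Ω → ℝ} (hX : IsIIDAdapted ℱ H E X) :
    IsIIDAdapted ℱ H E fun i => -X i where
  adapted i hi := ⟨H.neg_mem (hX.adapted i hi).1, (hX.adapted i hi).2.neg⟩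
  indep i hi A hA φ hφ h1 h2 :=
    hX.indep i hi A hA (fun p => φ (p.1, -p.2)) (hφ.comp (by fun_prop)) h1 h2
  law i hi φ hφ h1 h2 := hX.law i hi (fun x => φ (-x)) (hφ.comp measurable_neg) h1 h2

namespace IsSLSpace

theorem expect_add_condExpect (h : IsSLSpace ℱ H E) {k : ℕ} {W Y : Ω → ℝ}
    (hW : W ∈ adaptedPart ℱ H k) (hY : Y ∈ H) :
    expect E (fun ω => W ω + Y ω) = expect E (fun ω => W ω + E k Y ω) := by
  have h1 := h.expect_tower k (H.add_mem hW.1 hY)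
  rw [h.condExpect_add hY hW] at h1
  exact h1

/-- Independence of the past, tested on an event of the past: the coefficient `c - d` has to be
nonnegative because `ℰ` is only positively homogeneous. -/
theorem expect_indicator_comp_sub (h : IsSLSpace ℱ H E) {X : ℕ → Ω → ℝ}
    (hX : IsIIDAdapted ℱ H E X) {k : ℕ} {f : ℝ → ℝ} (hf : Measurable f)
    (hfX : (fun ω => f (X (k + 1) ω)) ∈ H) {A : Set Ω} (hA : MeasurableSet[ℱ k] A) {d : ℝ}
    (hd : d ≤ expect E fun ω => f (X (k + 1) ω)) :
    expect E (A.indicator fun ω => f (X (k + 1) ω) - d) =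
      ((expect E fun ω => f (X (k + 1) ω)) - d) * capacity E A := by
  have hg : (fun ω => f (X (k + 1) ω) - d) ∈ H := H.sub_mem hfX (h.isSpace.const_mem d)
  have hA' : MeasurableSet A := ℱ.le k A hA
  have h1 : (fun ω => A.indicator (fun _ => (1 : ℝ)) ω * (f (X (k + 1) ω) - d)) =
      A.indicator fun ω => f (X (k + 1) ω) - d := by
    ext ω
    by_cases hω : ω ∈ A <;> simp [hω]
  have h2 := (hX.indep (k + 1) (by omega) A hA (fun p => p.1 * (f p.2 - d)) (by fun_prop)
    (by simp only [h1]; exact h.isSpace.indicator_mem _ hg A hA')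
    (fun y => H.smul_mem y hg)).2
  simp only [h1] at h2
  have h3 : expect E (fun ω => f (X (k + 1) ω) - d) = (expect E fun ω => f (X (k + 1) ω)) - d := by
    have := h.expect_const_add hfX (-d)
    rw [sub_eq_neg_add, ← this]
    congr 1
    ext ω
    ring
  rw [h2, ← h.expect_indicator_const hA' (sub_nonneg.2 hd)]
  congr 1
  ext ω
  by_cases hω : ω ∈ A
  · simp [hω, h3]
  · simp [hω, h.expect_const]

/-- Independence of the past in terms of conditional expectations: quasi-surely, the conditional
expectation of a function of `X (k + 1)` given `ℱ k` is its expectation. -/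
theorem condExpect_comp_ae_eq (h : IsSLSpace ℱ H E) {X : ℕ → Ω → ℝ}
    (hX : IsIIDAdapted ℱ H E X) {k : ℕ} {f : ℝ → ℝ} (hf : Measurable f)
    (hfX : (fun ω => f (X (k + 1) ω)) ∈ H) :
    ∀ᵐ ω ∂(capacityOuter E),
      E k (fun ω => f (X (k + 1) ω)) ω = expect E fun ω => f (X (k + 1) ω) := by
  set c := expect E fun ω => f (X (k + 1) ω) with hc
  set D := E k fun ω => f (X (k + 1) ω) with hD
  have hDa : D ∈ adaptedPart ℱ H k := h.isSL.mapsTo k _ hfX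
  have hDd : ∀ d : ℝ, (fun ω => D ω - d) ∈ H := fun d => H.sub_mem hDa.1 (h.isSpace.const_mem d)
  have key : ∀ A : Set Ω, MeasurableSet[ℱ k] A → ∀ d ≤ c,
      expect E (A.indicator fun ω => D ω - d) = (c - d) * capacity E A := by
    intro A hA d hd
    have hg : (fun ω => f (X (k + 1) ω) - d) ∈ H := H.sub_mem hfX (h.isSpace.const_mem d)
    rw [← h.expect_indicator_comp_sub hX hf hfX hA hd,
      h.expect_tower k (h.isSpace.indicator_mem _ hg A (ℱ.le k A hA)),
      h.isSL.indicator k A hA _ hg]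
    have h1 := h.condExpect_add (k := k) hfX (Y := fun _ => -d)
      ⟨h.isSpace.const_mem _, measurable_const⟩
    have h2 : (fun ω => f (X (k + 1) ω) - d) = (fun _ => -d) + fun ω => f (X (k + 1) ω) := by
      ext ω
      simp only [Pi.add_apply]
      ring
    rw [h2, h1, ← hD]
    congr 2
    ext ω
    simp only [Pi.add_apply]
    ring
  -- The level `d = c` controls `{c + ε < D}`, the level `d = c - ε` controls `{D < c - ε}`.
  have hupper : ∀ ε > 0, ∀ᵐ ω ∂(capacityOuter E), D ω ≤ c + ε := by
    intro ε hε
    have hA : MeasurableSet[ℱ k] {ω | c + ε < D ω} :=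
      hDa.2 measurableSet_Ioi
    refine h.quasiSurely_iff.1 ⟨_, ℱ.le k _ hA, ?_, fun ω hω => not_lt.1 hω⟩
    have h1 := key _ hA c le_rfl
    rw [sub_self, zero_mul] at h1
    have h2 : expect E ({ω | c + ε < D ω}.indicator fun _ => ε) ≤
        expect E ({ω | c + ε < D ω}.indicator fun ω => D ω - c) := by
      refine h.expect_mono (h.isSpace.indicator_const_mem (ℱ.le k _ hA) ε)
        (h.isSpace.indicator_mem _ (hDd c) _ (ℱ.le k _ hA)) fun ω => ?_
      by_cases hω : c + ε < D ω
      · simp only [Set.indicator, Set.mem_ofPred_eq, hω, if_true]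
        linarith
      · simp [hω]
    rw [h1, h.expect_indicator_const (ℱ.le k _ hA) hε.le] at h2
    have h3 := h.capacity_nonneg (ℱ.le k _ hA)
    nlinarith
  have hlower : ∀ ε > 0, ∀ᵐ ω ∂(capacityOuter E), c - ε ≤ D ω := by
    intro ε hε
    have hA : MeasurableSet[ℱ k] {ω | D ω < c - ε} :=
      hDa.2 measurableSet_Iio
    refine h.quasiSurely_iff.1 ⟨_, ℱ.le k _ hA, ?_, fun ω hω => not_lt.1 hω⟩
    have h1 := key _ hA (c - ε) (by linarith)
    have h2 : expect E ({ω | D ω < c - ε}.indicator fun ω => D ω - (c - ε)) ≤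
        expect E (fun _ => (0 : ℝ)) := by
      refine h.expect_mono (h.isSpace.indicator_mem _ (hDd _) _ (ℱ.le k _ hA))
        (h.isSpace.const_mem 0) fun ω => ?_
      refine Set.indicator_apply_le' (fun hω => ?_) fun _ => le_rfl
      have h4 : D ω < c - ε := hω
      linarith
    rw [h1, h.expect_const] at h2
    have h3 := h.capacity_nonneg (ℱ.le k _ hA)
    nlinarith
  have hu : ∀ᵐ ω ∂(capacityOuter E), ∀ n : ℕ, D ω ≤ c + 1 / ((n : ℝ) + 1) :=
    ae_all_iff.2 fun n => hupper _ (by positivity)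
  have hl : ∀ᵐ ω ∂(capacityOuter E), ∀ n : ℕ, c - 1 / ((n : ℝ) + 1) ≤ D ω :=
    ae_all_iff.2 fun n => hlower _ (by positivity)
  filter_upwards [hu, hl] with ω h1 h2
  have hlim := tendsto_one_div_add_atTop_nhds_zero_nat (𝕜 := ℝ)
  have hu' := hlim.const_add c
  have hl' := hlim.const_sub c
  rw [add_zero] at hu'
  rw [sub_zero] at hl'
  exact le_antisymm (ge_of_tendsto' hu' h1) (le_of_tendsto' hl' h2)

end IsSLSpace

end

/-! ### Deterministic averages and series -/

theorem eventually_average_le {x : ℕ → ℝ} {c : ℝ} (hx : ∀ᶠ i in atTop, x i ≤ c) {ε : ℝ}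
    (hε : 0 < ε) : ∀ᶠ n : ℕ in atTop, (∑ i ∈ Finset.Icc 1 n, x i) / (n : ℝ) ≤ c + ε := by
  obtain ⟨m, hm⟩ := eventually_atTop.1 hx
  set K := ∑ i ∈ Finset.Icc 1 m, |x i - c| with hK
  have hlim : Tendsto (fun n : ℕ => K / (n : ℝ)) atTop (𝓝 0) :=
    tendsto_const_div_atTop_nhds_zero_nat K
  filter_upwards [hlim.eventually_lt_const hε, eventually_ge_atTop 1] with n hn hn1
  have hn0 : (0 : ℝ) < n := by exact_mod_cast hn1
  have h1 : ∑ i ∈ Finset.Icc 1 n, (x i - c) ≤ K := by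
    calc ∑ i ∈ Finset.Icc 1 n, (x i - c)
        ≤ ∑ i ∈ Finset.Icc 1 n, if i ≤ m then |x i - c| else 0 := by
          refine Finset.sum_le_sum fun i _ => ?_
          split_ifs with h
          · exact le_abs_self _
          · linarith [hm i (by omega)]
      _ = ∑ i ∈ (Finset.Icc 1 n).filter (· ≤ m), |x i - c| := (Finset.sum_filter _ _).symm
      _ ≤ K := by
          refine Finset.sum_le_sum_of_subset_of_nonneg (fun i hi => ?_) fun _ _ _ => abs_nonneg _
          simp only [Finset.mem_filter, Finset.mem_Icc] at hi ⊢
          omega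
  rw [Finset.sum_sub_distrib, Finset.sum_const, Nat.card_Icc, nsmul_eq_mul] at h1
  simp only [Nat.add_sub_cancel] at h1
  rw [div_lt_iff₀ hn0] at hn
  rw [div_le_iff₀ hn0]
  linarith

/-- The weights `m + 1` of truncated second moments are absorbed by interchanging the summations,
as the tail of `∑ 1 / i ^ 2` beyond `m` is at most `2 / (m + 1)`. -/
theorem summable_sum_mul_div_sq {e : ℕ → ℝ} (he0 : ∀ m, 0 ≤ e m) (he : Summable e) :
    Summable fun i : ℕ => (∑ m ∈ Finset.range i, ((m : ℝ) + 1) * e m) / (i : ℝ) ^ 2 := by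
  refine summable_of_sum_range_le (c := 2 * ∑' m, e m) (fun i => ?_) fun n => ?_
  · exact div_nonneg (Finset.sum_nonneg fun m _ => mul_nonneg (by positivity) (he0 m))
      (by positivity)
  · have h1 : ∀ i ∈ Finset.range n, (∑ m ∈ Finset.range i, ((m : ℝ) + 1) * e m) / (i : ℝ) ^ 2 =
        ∑ m ∈ Finset.range n, if m < i then ((m : ℝ) + 1) * e m * ((i : ℝ) ^ 2)⁻¹ else 0 := by
      intro i hi
      rw [div_eq_mul_inv, Finset.sum_mul, ← Finset.sum_filter]
      refine Finset.sum_congr ?_ fun _ _ => rfl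
      ext m
      simp only [Finset.mem_range, Finset.mem_filter] at hi ⊢
      omega
    rw [Finset.sum_congr rfl h1, Finset.sum_comm]
    calc ∑ m ∈ Finset.range n, ∑ i ∈ Finset.range n,
          (if m < i then ((m : ℝ) + 1) * e m * ((i : ℝ) ^ 2)⁻¹ else 0)
        ≤ ∑ m ∈ Finset.range n, 2 * e m := by
          refine Finset.sum_le_sum fun m _ => ?_
          have h2 : (Finset.range n).filter (m < ·) = Finset.Ioo m n := by
            ext i
            simp only [Finset.mem_range, Finset.mem_filter, Finset.mem_Ioo]
            omega
          rw [← Finset.sum_filter, h2, ← Finset.mul_sum]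
          calc ((m : ℝ) + 1) * e m * ∑ i ∈ Finset.Ioo m n, ((i : ℝ) ^ 2)⁻¹
              ≤ ((m : ℝ) + 1) * e m * (2 / ((m : ℝ) + 1)) :=
                mul_le_mul_of_nonneg_left (sum_Ioo_inv_sq_le m n)
                  (mul_nonneg (by positivity) (he0 m))
            _ = 2 * e m := by field_simp
      _ ≤ 2 * ∑' m, e m := by
          rw [← Finset.mul_sum]
          exact mul_le_mul_of_nonneg_left (he.sum_le_tsum _ fun m _ => he0 m) (by norm_num)

/-! ### A one-sided maximal inequality -/

namespace IsSLSpace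

variable {Ω : Type*} [mΩ : MeasurableSpace Ω] [Nonempty Ω] {ℱ : Filtration ℕ mΩ}
  {H : Submodule ℝ (Ω → ℝ)} {E : ℕ → (Ω → ℝ) → (Ω → ℝ)}

/-- A Hájek–Rényi inequality for the averages of simple increments with nonpositive conditional
expectations. The square of the positive part is used because the square of an
`ℰ`-supermartingale need not have controlled growth, whereas
`(a + b)⁺ ^ 2 ≤ a⁺ ^ 2 + 2 * a⁺ * b + b ^ 2` has a nonnegative coefficient in front of `b`. -/
theorem capacity_exists_lt_sum_le (h : IsSLSpace ℱ H E) {U : ℕ → Ω → ℝ} {v : ℕ → ℝ}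
    (hU : ∀ i, IsSimple (ℱ i) (U i)) (hv : ∀ i, 0 ≤ v i)
    (h1 : ∀ k, ∀ᵐ ω ∂(capacityOuter E), E k (U (k + 1)) ω ≤ 0)
    (h2 : ∀ k, ∀ᵐ ω ∂(capacityOuter E), E k (fun ω => U (k + 1) ω ^ 2) ω ≤ v (k + 1))
    {ε : ℝ} (hε : 0 < ε) {n : ℕ} (hn : 1 ≤ n) {k : ℕ} (hk : n ≤ k) :
    ε ^ 2 * capacity E {ω | ∃ j ∈ Finset.Icc n k, ε * j < ∑ i ∈ Finset.Ioc n j, U i ω} ≤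
      ∑ i ∈ Finset.Ioc n k, v i / (i : ℝ) ^ 2 := by
  set T : ℕ → Ω → ℝ := fun k ω => ∑ i ∈ Finset.Ioc n k, U i ω with hT
  set C : ℕ → Set Ω := fun k => {ω | ∃ j ∈ Finset.Icc n k, ε * j < T j ω} with hC
  have hTs : ∀ k, IsSimple (ℱ k) (T k) := fun k => IsSimple.sum fun i hi =>
    (hU i).mono (ℱ.mono (Finset.mem_Ioc.1 hi).2)
  have hCm : ∀ k, MeasurableSet[ℱ k] (C k) := by
    intro k
    have : C k = ⋃ j ∈ Finset.Icc n k, T j ⁻¹' Set.Ioi (ε * j) := by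
      ext ω
      simp [hC]
    rw [this]
    exact Finset.measurableSet_biUnion _ fun j hj =>
      (hTs j).1.mono (ℱ.mono (Finset.mem_Icc.1 hj).2) le_rfl measurableSet_Ioi
  -- The process stopped on entering the exceptional set, with the value `ε ^ 2` there.
  set Q : ℕ → Ω → ℝ := fun k ω => (C k).indicator (fun _ => ε ^ 2) ω +
    (C k)ᶜ.indicator (fun ω => max (T k ω) 0 ^ 2 / (k : ℝ) ^ 2) ω with hQ
  have hQs : ∀ k, IsSimple (ℱ k) (Q k) := fun k =>
    ((IsSimple.const _).indicator (hCm k)).add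
      (((hTs k).comp (φ := fun x => max x 0 ^ 2 / (k : ℝ) ^ 2) (by fun_prop)).indicator
        (hCm k).compl)
  have hQH : ∀ k, Q k ∈ H := fun k => (h.adapted_of_isSimple (hQs k)).1
  have main : ∀ k, n ≤ k → expect E (Q k) ≤ ∑ i ∈ Finset.Ioc n k, v i / (i : ℝ) ^ 2 := by
    intro k hk
    induction k, hk using Nat.le_induction with
    | base =>
      have hCn : C n = ∅ := by
        ext ω
        simp only [hC, hT, Finset.Icc_self, Finset.mem_singleton, exists_eq_left,
          Finset.Ioc_self, Finset.sum_empty, Set.mem_ofPred_eq, Set.mem_empty_iff_false, iff_false,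
          not_lt]
        positivity
      have hQn : Q n = fun _ => 0 := by
        ext ω
        simp [hQ, hCn, hT]
      simp [hQn, h.expect_const]
    | succ k hk ih =>
      have hk0 : (0 : ℝ) < k := by exact_mod_cast lt_of_lt_of_le hn hk
      set l₁ : Ω → ℝ := (C k)ᶜ.indicator fun ω => 2 * max (T k ω) 0 / ((k : ℝ) + 1) ^ 2 with hl₁
      set l₂ : Ω → ℝ := (C k)ᶜ.indicator fun _ => 1 / ((k : ℝ) + 1) ^ 2 with hl₂
      have hl₁s : IsSimple (ℱ k) l₁ :=
        ((hTs k).comp (φ := fun x => 2 * max x 0 / ((k : ℝ) + 1) ^ 2) (by fun_prop)).indicator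
          (hCm k).compl
      have hl₂s : IsSimple (ℱ k) l₂ := (IsSimple.const _).indicator (hCm k).compl
      have hl₁0 : ∀ ω, 0 ≤ l₁ ω := fun ω =>
        Set.indicator_nonneg (fun ω _ => by positivity) ω
      have hl₂0 : ∀ ω, 0 ≤ l₂ ω := fun ω =>
        Set.indicator_nonneg (fun ω _ => by positivity) ω
      have hl₂1 : ∀ ω, l₂ ω ≤ 1 / ((k : ℝ) + 1) ^ 2 := fun ω =>
        Set.indicator_le_self' (fun _ _ => by positivity) ω
      have hUs := hU (k + 1)
      have hU2s : IsSimple (ℱ (k + 1)) fun ω => U (k + 1) ω ^ 2 :=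
        hUs.comp (φ := fun x => x ^ 2) (by fun_prop)
      have hkk : ℱ k ≤ ℱ (k + 1) := ℱ.mono (Nat.le_succ k)
      have ha := (h.adapted_of_isSimple ((hl₁s.mono hkk).mul hUs)).1
      have hb := (h.adapted_of_isSimple ((hl₂s.mono hkk).mul hU2s)).1
      have hstep : ∀ ω, Q (k + 1) ω ≤
          Q k ω + (l₁ ω * U (k + 1) ω + l₂ ω * U (k + 1) ω ^ 2) := by
        intro ω
        have hsub : ω ∈ C k → ω ∈ C (k + 1) := by
          rintro ⟨j, hj, hlt⟩
          exact ⟨j, Finset.Icc_subset_Icc_right (Nat.le_succ k) hj, hlt⟩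
        by_cases hω : ω ∈ C k
        · simp [hQ, hl₁, hl₂, hω, hsub hω]
        · have hTk : T (k + 1) ω = T k ω + U (k + 1) ω := by
            simp only [hT]
            rw [Finset.sum_Ioc_succ_top hk]
          have hQ1 : Q (k + 1) ω ≤ max (T (k + 1) ω) 0 ^ 2 / ((k : ℝ) + 1) ^ 2 := by
            by_cases hω1 : ω ∈ C (k + 1)
            · have h3 : ε * ((k : ℝ) + 1) < T (k + 1) ω := by
                obtain ⟨j, hj, hlt⟩ := hω1
                rcases (Finset.mem_Icc.1 hj).2.lt_or_eq with hjk | hjk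
                · exact absurd ⟨j, Finset.mem_Icc.2 ⟨(Finset.mem_Icc.1 hj).1,
                    Nat.lt_succ_iff.1 hjk⟩, hlt⟩ hω
                · rw [hjk] at hlt
                  exact_mod_cast hlt
              simp only [hQ, Set.indicator_of_mem hω1, Set.mem_compl_iff, hω1, not_true,
                not_false_eq_true, Set.indicator_of_notMem, add_zero]
              rw [le_div_iff₀ (by positivity), ← mul_pow]
              exact pow_le_pow_left₀ (by positivity) (h3.le.trans (le_max_left _ _)) 2
            · simp [hQ, hω1]
          have hQk : max (T k ω) 0 ^ 2 / ((k : ℝ) + 1) ^ 2 ≤ Q k ω := by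
            simp only [hQ, hω, Set.mem_compl_iff, not_false_eq_true, Set.indicator_of_notMem,
              Set.indicator_of_mem, zero_add]
            gcongr
            linarith
          have hsq : max (T (k + 1) ω) 0 ^ 2 ≤
              max (T k ω) 0 ^ 2 + 2 * max (T k ω) 0 * U (k + 1) ω + U (k + 1) ω ^ 2 := by
            have h4 : max (T (k + 1) ω) 0 ≤ |max (T k ω) 0 + U (k + 1) ω| := by
              refine max_le ?_ (abs_nonneg _)
              rw [hTk]
              exact le_trans (by linarith [le_max_left (T k ω) 0]) (le_abs_self _)
            calc max (T (k + 1) ω) 0 ^ 2 ≤ |max (T k ω) 0 + U (k + 1) ω| ^ 2 :=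
                  pow_le_pow_left₀ (le_max_right _ _) h4 2
              _ = _ := by rw [sq_abs]; ring
          have hl₁ω : l₁ ω = 2 * max (T k ω) 0 / ((k : ℝ) + 1) ^ 2 := by simp [hl₁, hω]
          have hl₂ω : l₂ ω = 1 / ((k : ℝ) + 1) ^ 2 := by simp [hl₂, hω]
          rw [hl₁ω, hl₂ω]
          calc Q (k + 1) ω ≤ max (T (k + 1) ω) 0 ^ 2 / ((k : ℝ) + 1) ^ 2 := hQ1
            _ ≤ (max (T k ω) 0 ^ 2 + 2 * max (T k ω) 0 * U (k + 1) ω + U (k + 1) ω ^ 2) /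
                  ((k : ℝ) + 1) ^ 2 := by gcongr
            _ = max (T k ω) 0 ^ 2 / ((k : ℝ) + 1) ^ 2 +
                  (2 * max (T k ω) 0 / ((k : ℝ) + 1) ^ 2 * U (k + 1) ω +
                    1 / ((k : ℝ) + 1) ^ 2 * U (k + 1) ω ^ 2) := by ring
            _ ≤ _ := by gcongr
      have hcond : ∀ᵐ ω ∂(capacityOuter E),
          E k (fun ω => l₁ ω * U (k + 1) ω + l₂ ω * U (k + 1) ω ^ 2) ω ≤
            v (k + 1) / ((k : ℝ) + 1) ^ 2 := by
        filter_upwards [h1 k, h2 k] with ω hω1 hω2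
        have h5 := h.isSL.subadd k _ ha _ hb ω
        have h6 := h.condExpect_mul (h.adapted_of_isSimple hl₁s) hl₁0
          (h.adapted_of_isSimple hUs).1 ha ω
        have h7 := h.condExpect_mul (h.adapted_of_isSimple hl₂s) hl₂0
          (h.adapted_of_isSimple hU2s).1 hb ω
        rw [Pi.add_apply, h6, h7] at h5
        refine le_trans h5 ?_
        have h8 := mul_nonpos_of_nonneg_of_nonpos (hl₁0 ω) hω1
        have h9 : l₂ ω * E k (fun ω => U (k + 1) ω ^ 2) ω ≤
            1 / ((k : ℝ) + 1) ^ 2 * v (k + 1) :=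
          (mul_le_mul_of_nonneg_left hω2 (hl₂0 ω)).trans
            (mul_le_mul_of_nonneg_right (hl₂1 ω) (hv _))
        calc _ ≤ 0 + 1 / ((k : ℝ) + 1) ^ 2 * v (k + 1) := add_le_add h8 h9
          _ = _ := by ring
      have hab : (fun ω => l₁ ω * U (k + 1) ω + l₂ ω * U (k + 1) ω ^ 2) ∈ H := H.add_mem ha hb
      calc expect E (Q (k + 1))
          ≤ expect E (fun ω => Q k ω + (l₁ ω * U (k + 1) ω + l₂ ω * U (k + 1) ω ^ 2)) :=
            h.expect_mono (hQH _) (H.add_mem (hQH k) hab) hstep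
        _ = expect E (fun ω => Q k ω +
              E k (fun ω => l₁ ω * U (k + 1) ω + l₂ ω * U (k + 1) ω ^ 2) ω) :=
            h.expect_add_condExpect (h.adapted_of_isSimple (hQs k)) hab
        _ ≤ expect E (fun ω => v (k + 1) / ((k : ℝ) + 1) ^ 2 + Q k ω) := by
            refine h.expect_le_of_ae (H.add_mem (hQH k) (h.condExpect_mem k hab))
              (H.add_mem (h.isSpace.const_mem _) (hQH k)) ?_
            filter_upwards [hcond] with ω hω
            linarith
        _ = v (k + 1) / ((k : ℝ) + 1) ^ 2 + expect E (Q k) := h.expect_const_add (hQH k) _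
        _ ≤ _ := by
            rw [Finset.sum_Ioc_succ_top hk]
            push_cast
            linarith
  refine le_trans ?_ (main k hk)
  rw [← h.expect_indicator_const (ℱ.le k _ (hCm k)) (by positivity)]
  refine h.expect_mono (h.isSpace.indicator_const_mem (ℱ.le k _ (hCm k)) _) (hQH k) fun ω => ?_
  exact le_add_of_nonneg_right (Set.indicator_nonneg (fun ω _ => by positivity) ω)

/-- The one-sided law of large numbers for simple increments with nonpositive conditional
expectations. -/
theorem ae_eventually_average_le (h : IsSLSpace ℱ H E) {U : ℕ → Ω → ℝ} {v : ℕ → ℝ}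
    (hU : ∀ i, IsSimple (ℱ i) (U i)) (hv : ∀ i, 0 ≤ v i)
    (hsum : Summable fun i : ℕ => v i / (i : ℝ) ^ 2)
    (h1 : ∀ k, ∀ᵐ ω ∂(capacityOuter E), E k (U (k + 1)) ω ≤ 0)
    (h2 : ∀ k, ∀ᵐ ω ∂(capacityOuter E), E k (fun ω => U (k + 1) ω ^ 2) ω ≤ v (k + 1))
    {ε : ℝ} (hε : 0 < ε) :
    ∀ᵐ ω ∂(capacityOuter E), ∀ᶠ n : ℕ in atTop,
      (∑ i ∈ Finset.Icc 1 n, U i ω) / (n : ℝ) ≤ ε := by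
  refine h.ae_of_forall_capacity_le fun δ hδ => ?_
  have hε2 : 0 < ε / 2 := half_pos hε
  -- Restarting the sum at a late time `n` makes the bound of the maximal inequality small.
  obtain ⟨n, hn1, hn⟩ : ∃ n : ℕ, 1 ≤ n ∧ ∀ k,
      ∑ i ∈ Finset.Ioc n k, v i / (i : ℝ) ^ 2 ≤ (ε / 2) ^ 2 * δ := by
    obtain ⟨s, hs⟩ := summable_iff_vanishing_norm.1 hsum ((ε / 2) ^ 2 * δ) (by positivity)
    refine ⟨s.sup id + 1, by omega, fun k => (le_abs_self _).trans (hs _ ?_).le⟩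
    rw [Finset.disjoint_left]
    intro i hi hi'
    have h3 : i ≤ s.sup id := Finset.le_sup (f := id) hi'
    have h4 := (Finset.mem_Ioc.1 hi).1
    omega
  set C : ℕ → Set Ω := fun k =>
    {ω | ∃ j ∈ Finset.Icc n k, ε / 2 * j < ∑ i ∈ Finset.Ioc n j, U i ω} with hC
  have hCm : ∀ k, MeasurableSet (C k) := by
    intro k
    have : C k = ⋃ j ∈ Finset.Icc n k, (fun ω => ∑ i ∈ Finset.Ioc n j, U i ω) ⁻¹'
        Set.Ioi (ε / 2 * j) := by
      ext ω
      simp [hC]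
    rw [this]
    exact Finset.measurableSet_biUnion _ fun j _ =>
      (Finset.measurable_fun_sum _ fun i _ => ((hU i).mono (ℱ.le i)).1) measurableSet_Ioi
  have hCk : ∀ k, capacity E (C k) ≤ δ := by
    intro k
    have hle : C k ⊆ C (max n k) := by
      rintro ω ⟨j, hj, hlt⟩
      exact ⟨j, Finset.Icc_subset_Icc_right (le_max_right _ _) hj, hlt⟩
    have h3 := h.capacity_exists_lt_sum_le hU hv h1 h2 hε2 hn1 (le_max_left n k)
    have h4 := h3.trans (hn _)
    exact (h.capacity_mono (hCm k) (hCm _) hle).trans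
      (le_of_mul_le_mul_left h4 (by positivity))
  have hUm : MeasurableSet (⋃ k, C k) := MeasurableSet.iUnion hCm
  have hlim := h.tendsto_capacity_of_antitone (D := fun k => (⋃ k, C k) \ C k)
    (fun k => hUm.diff (hCm k))
    (fun k k' hkk => Set.sdiff_subset_sdiff_right (by
      rintro ω ⟨j, hj, hlt⟩
      exact ⟨j, Finset.Icc_subset_Icc_right hkk hj, hlt⟩))
    (fun ω => by
      by_cases hω : ω ∈ ⋃ k, C k
      · obtain ⟨k, hk⟩ := Set.mem_iUnion.1 hω
        exact ⟨k, fun h' => h'.2 hk⟩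
      · exact ⟨0, fun h' => hω h'.1⟩)
  refine ⟨⋃ k, C k, hUm, ?_, fun ω hω => ?_⟩
  · have hlim' := hlim.add_const δ
    rw [zero_add] at hlim'
    refine ge_of_tendsto' hlim' fun k => ?_
    have h3 := h.capacity_union_le (hUm.diff (hCm k)) (hCm k)
    rw [Set.sdiff_union_of_subset (Set.subset_iUnion C k)] at h3
    linarith [hCk k]
  · have hlim0 : Tendsto (fun k : ℕ => (∑ i ∈ Finset.Icc 1 n, U i ω) / (k : ℝ)) atTop (𝓝 0) :=
      tendsto_const_div_atTop_nhds_zero_nat _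
    filter_upwards [hlim0.eventually_lt_const hε2, eventually_ge_atTop n] with k hk hnk
    have hk0 : (0 : ℝ) < k := by exact_mod_cast lt_of_lt_of_le hn1 hnk
    have h3 : ∑ i ∈ Finset.Ioc n k, U i ω ≤ ε / 2 * k := by
      by_contra hlt
      exact hω (Set.mem_iUnion.2 ⟨k, k, Finset.mem_Icc.2 ⟨hnk, le_rfl⟩, not_le.1 hlt⟩)
    have h4 : ∑ i ∈ Finset.Icc 1 k, U i ω =
        ∑ i ∈ Finset.Icc 1 n, U i ω + ∑ i ∈ Finset.Ioc n k, U i ω := by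
      rw [← Finset.sum_union (Finset.disjoint_left.2 fun i hi hi' => by
        simp only [Finset.mem_Icc, Finset.mem_Ioc] at hi hi'; omega)]
      refine Finset.sum_congr ?_ fun _ _ => rfl
      ext i
      simp only [Finset.mem_Icc, Finset.mem_Ioc, Finset.mem_union]
      omega
    rw [div_lt_iff₀ hk0] at hk
    rw [div_le_iff₀ hk0, h4]
    linarith

end IsSLSpace

/-! ### Discretized truncations -/

/-- The truncation of `x` at level `i`, rounded up to the next multiple of `1 / i`. The rounding
makes it a function with finitely many values. -/
noncomputable def roundTrunc (i : ℕ) (x : ℝ) : ℝ :=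
  if |x| ≤ i then (⌈(i : ℝ) * x⌉ : ℝ) / i else 0

theorem measurable_roundTrunc (i : ℕ) : Measurable (roundTrunc i) := by
  unfold roundTrunc
  refine Measurable.ite (measurableSet_le (by fun_prop) measurable_const) ?_ measurable_const
  exact ((measurable_from_top (f := fun z : ℤ => (z : ℝ))).comp
    (Int.measurable_ceil.comp (measurable_const_mul (i : ℝ)))).div_const _

theorem finite_range_roundTrunc (i : ℕ) : (Set.range (roundTrunc i)).Finite := by
  refine ((Set.finite_Icc (-((i : ℤ) ^ 2)) ((i : ℤ) ^ 2)).image fun z : ℤ => (z : ℝ) / i).subset ?_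
  rintro _ ⟨x, rfl⟩
  by_cases hx : |x| ≤ i
  · refine ⟨⌈(i : ℝ) * x⌉, ⟨?_, ?_⟩, by simp [roundTrunc, hx]⟩
    · have h1 : -((i : ℝ) ^ 2) ≤ i * x := by
        nlinarith [abs_le.1 hx, (Nat.cast_nonneg i : (0 : ℝ) ≤ i)]
      have h2 : ((-((i : ℤ) ^ 2) : ℤ) : ℝ) ≤ ⌈(i : ℝ) * x⌉ := by
        push_cast
        exact h1.trans (Int.le_ceil _)
      exact_mod_cast h2
    · refine Int.ceil_le.2 ?_
      push_cast
      nlinarith [abs_le.1 hx, (Nat.cast_nonneg i : (0 : ℝ) ≤ i)]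
  · exact ⟨0, ⟨by simp, by positivity⟩, by simp [roundTrunc, hx]⟩

theorem isSimple_roundTrunc {Ω : Type*} {m : MeasurableSpace Ω} {Y : Ω → ℝ} (hY : Measurable[m] Y)
    (i : ℕ) : IsSimple m fun ω => roundTrunc i (Y ω) := by
  refine ⟨(measurable_roundTrunc i).comp hY, (finite_range_roundTrunc i).subset ?_⟩
  rintro _ ⟨ω, rfl⟩
  exact ⟨_, rfl⟩

theorem IsRandomVariableSpace.roundTrunc_mem {Ω : Type*} [MeasurableSpace Ω]
    {H : Submodule ℝ (Ω → ℝ)} (hH : IsRandomVariableSpace H) {Y : Ω → ℝ} (hY : Y ∈ H) (i : ℕ) :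
    (fun ω => roundTrunc i (Y ω)) ∈ H :=
  have hs := isSimple_roundTrunc (hH.measurable _ hY) i
  hH.mem_of_finite_range hs.1 hs.2

theorem le_roundTrunc {i : ℕ} (hi : 1 ≤ i) {x : ℝ} (hx : |x| ≤ i) : x ≤ roundTrunc i x := by
  have hi0 : (0 : ℝ) < i := by exact_mod_cast hi
  rw [roundTrunc, if_pos hx, le_div_iff₀ hi0, mul_comm]
  exact Int.le_ceil _

theorem roundTrunc_le {i : ℕ} (hi : 1 ≤ i) {x : ℝ} (hx : |x| ≤ i) :
    roundTrunc i x ≤ x + 1 / i := by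
  have hi0 : (0 : ℝ) < i := by exact_mod_cast hi
  rw [roundTrunc, if_pos hx, div_le_iff₀ hi0, add_mul, one_div, inv_mul_cancel₀ hi0.ne', mul_comm]
  exact (Int.ceil_lt_add_one _).le

theorem abs_roundTrunc_le {i : ℕ} (hi : 1 ≤ i) (x : ℝ) : |roundTrunc i x| ≤ |x| + 1 := by
  by_cases hx : |x| ≤ i
  · have hi1 : (1 : ℝ) ≤ i := by exact_mod_cast hi
    have h1 := le_roundTrunc hi hx
    have h2 := roundTrunc_le hi hx
    have h3 : 1 / (i : ℝ) ≤ 1 := by rw [div_le_one (by linarith)]; exact hi1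
    rw [abs_le]
    constructor <;> linarith [neg_abs_le x, le_abs_self x]
  · simp only [roundTrunc, hx, if_false, abs_zero]
    positivity

/-- On `{|x| ≤ i}` the square of `x` is bounded slab by slab. -/
theorem sq_le_sum_slab {i : ℕ} {x : ℝ} (hx : |x| ≤ i) :
    x ^ 2 ≤ ∑ m ∈ Finset.range i,
      ((m : ℝ) + 1) * {y : ℝ | (m : ℝ) < |y| ∧ |y| ≤ (m : ℝ) + 1}.indicator (fun y => |y|) x := by
  have hnn : ∀ m ∈ Finset.range i, 0 ≤ ((m : ℝ) + 1) *
      {y : ℝ | (m : ℝ) < |y| ∧ |y| ≤ (m : ℝ) + 1}.indicator (fun y => |y|) x := fun m _ =>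
    mul_nonneg (by positivity) (Set.indicator_nonneg (fun _ _ => abs_nonneg _) _)
  rcases eq_or_ne x 0 with rfl | hx0
  · simp
  · have hpos : 0 < |x| := abs_pos.2 hx0
    obtain ⟨m, hm⟩ : ∃ m, ⌈|x|⌉₊ = m + 1 :=
      Nat.exists_eq_succ_of_ne_zero (Nat.ceil_pos.2 hpos).ne'
    have h1 : (m : ℝ) < |x| := Nat.lt_ceil.1 (by omega)
    have h2 : |x| ≤ (m : ℝ) + 1 := by
      have := Nat.le_ceil |x|
      rw [hm] at this
      exact_mod_cast this
    have hmi : m ∈ Finset.range i := by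
      rw [Finset.mem_range]
      exact_mod_cast h1.trans_le hx
    refine le_trans ?_ (Finset.single_le_sum hnn hmi)
    rw [Set.indicator_of_mem (show x ∈ {y : ℝ | (m : ℝ) < |y| ∧ |y| ≤ (m : ℝ) + 1} from ⟨h1, h2⟩),
      ← sq_abs, sq]
    exact mul_le_mul_of_nonneg_right h2 hpos.le

/-! ### The upper half of the strong law -/

namespace IsSLSpace

variable {Ω : Type*} [mΩ : MeasurableSpace Ω] [Nonempty Ω] {ℱ : Filtration ℕ mΩ}
  {H : Submodule ℝ (Ω → ℝ)} {E : ℕ → (Ω → ℝ) → (Ω → ℝ)} {X : ℕ → Ω → ℝ}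

theorem abs_expect_roundTrunc_le (h : IsSLSpace ℱ H E) {Y : Ω → ℝ} (hY : Y ∈ H) {i : ℕ}
    (hi : 1 ≤ i) :
    |expect E fun ω => roundTrunc i (Y ω)| ≤ 1 + expect E fun ω => |Y ω| := by
  have hm := h.isSpace.roundTrunc_mem hY i
  have ha := h.isSpace.abs_mem Y hY
  have h1 : ∀ Z ∈ H, (∀ ω, Z ω ≤ 1 + |Y ω|) → expect E Z ≤ 1 + expect E fun ω => |Y ω| :=
    fun Z hZ hle => by
      rw [← h.expect_const_add ha]
      exact h.expect_mono hZ (H.add_mem (h.isSpace.const_mem 1) ha) hle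
  have h2 := h1 _ hm fun ω => by
    linarith [abs_roundTrunc_le hi (Y ω), le_abs_self (roundTrunc i (Y ω))]
  have h3 := h1 _ (H.neg_mem hm) fun ω => by
    simp only [Pi.neg_apply]
    linarith [abs_roundTrunc_le hi (Y ω), neg_abs_le (roundTrunc i (Y ω))]
  have h4 := h.neg_expect_neg_le hm
  rw [abs_le]
  constructor <;> linarith

theorem eventually_expect_roundTrunc_le (h : IsSLSpace ℱ H E) {Y : Ω → ℝ} (hY : Y ∈ H) {ε : ℝ}
    (hε : 0 < ε) :
    ∀ᶠ i : ℕ in atTop, (expect E fun ω => roundTrunc i (Y ω)) ≤ expect E Y + ε := by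
  have hlim : Tendsto (fun i : ℕ => 1 / (i : ℝ) +
      expect E ({ω | (i : ℝ) < |Y ω|}.indicator fun ω => |Y ω|)) atTop (𝓝 0) := by
    simpa using (tendsto_const_div_atTop_nhds_zero_nat (1 : ℝ)).add (h.tendsto_expect_tail hY)
  filter_upwards [hlim.eventually_lt_const hε, eventually_ge_atTop 1] with i hi hi1
  have hA : MeasurableSet {ω | (i : ℝ) < |Y ω|} :=
    measurableSet_lt measurable_const (h.isSpace.measurable _ (h.isSpace.abs_mem Y hY))
  have ht := h.isSpace.indicator_mem _ (h.isSpace.abs_mem Y hY) _ hA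
  have h1 : (fun ω => 1 / (i : ℝ) + Y ω) ∈ H := H.add_mem (h.isSpace.const_mem _) hY
  have h2 := h.expect_mono (h.isSpace.roundTrunc_mem hY i) (H.add_mem h1 ht) fun ω => by
    by_cases hω : (i : ℝ) < |Y ω|
    · have : ¬ |Y ω| ≤ i := not_le.2 hω
      simp only [roundTrunc, this, if_false, Pi.add_apply]
      rw [Set.indicator_of_mem (show ω ∈ {ω | (i : ℝ) < |Y ω|} from hω)]
      have : 0 ≤ 1 / (i : ℝ) := by positivity
      linarith [neg_abs_le (Y ω)]
    · have := roundTrunc_le hi1 (not_lt.1 hω)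
      simp only [Pi.add_apply]
      rw [Set.indicator_of_notMem (show ω ∉ {ω | (i : ℝ) < |Y ω|} from hω)]
      linarith
  have h3 := h.expect_add_le h1 ht
  rw [h.expect_const_add hY] at h3
  have h4 := h2.trans h3
  linarith

/-- The second moment of the centered truncation, in terms of the slab expectations. -/
theorem expect_sq_roundTrunc_sub_le (h : IsSLSpace ℱ H E) {Y : Ω → ℝ} (hY : Y ∈ H) {i : ℕ}
    (hi : 1 ≤ i) {b K : ℝ} (hb : |b| ≤ K) :
    (expect E fun ω => (roundTrunc i (Y ω) - b) ^ 2) ≤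
      (4 + 2 * K ^ 2) + 4 * ∑ m ∈ Finset.range i, ((m : ℝ) + 1) *
        expect E ({ω | (m : ℝ) < |Y ω| ∧ |Y ω| ≤ (m : ℝ) + 1}.indicator fun ω => |Y ω|) := by
  have hYm := h.isSpace.measurable _ (h.isSpace.abs_mem Y hY)
  set e : ℕ → Ω → ℝ := fun m =>
    {ω | (m : ℝ) < |Y ω| ∧ |Y ω| ≤ (m : ℝ) + 1}.indicator fun ω => |Y ω| with he
  have heH : ∀ m, e m ∈ H := fun m => h.isSpace.indicator_mem _ (h.isSpace.abs_mem Y hY) _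
    ((measurableSet_lt measurable_const hYm).inter (measurableSet_le hYm measurable_const))
  have hsq : IsSimple mΩ fun ω => (roundTrunc i (Y ω) - b) ^ 2 :=
    (isSimple_roundTrunc (h.isSpace.measurable _ hY) i).comp (φ := fun x => (x - b) ^ 2)
      (by fun_prop)
  have hmH : ∀ m ∈ Finset.range i, (fun ω => ((m : ℝ) + 1) * e m ω) ∈ H := fun m _ =>
    H.smul_mem ((m : ℝ) + 1) (heH m)
  have hsH : (fun ω => ∑ m ∈ Finset.range i, ((m : ℝ) + 1) * e m ω) ∈ H := by
    have := H.sum_mem hmH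
    convert this using 1
    ext ω
    simp
  have h4H : (fun ω => 4 * ∑ m ∈ Finset.range i, ((m : ℝ) + 1) * e m ω) ∈ H :=
    H.smul_mem 4 hsH
  -- With `r = roundTrunc i y`: `(r - b) ^ 2 ≤ 2 * r ^ 2 + 2 * b ^ 2` and `r ^ 2 ≤ 2 * y ^ 2 + 2`.
  have hpt : ∀ ω, (roundTrunc i (Y ω) - b) ^ 2 ≤
      (4 + 2 * K ^ 2) + 4 * ∑ m ∈ Finset.range i, ((m : ℝ) + 1) * e m ω := by
    intro ω
    have hbK : b ^ 2 ≤ K ^ 2 := by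
      rw [← sq_abs b]
      exact pow_le_pow_left₀ (abs_nonneg b) hb 2
    have h2 : (roundTrunc i (Y ω) - b) ^ 2 ≤ 2 * roundTrunc i (Y ω) ^ 2 + 2 * b ^ 2 := by
      nlinarith [sq_nonneg (roundTrunc i (Y ω) + b)]
    have h0 : 0 ≤ ∑ m ∈ Finset.range i, ((m : ℝ) + 1) * e m ω :=
      Finset.sum_nonneg fun m _ => mul_nonneg (by positivity)
        (Set.indicator_nonneg (fun _ _ => abs_nonneg _) _)
    by_cases hω : |Y ω| ≤ i
    · have h3 := sq_le_sum_slab hω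
      have h5 : roundTrunc i (Y ω) ^ 2 ≤ 2 * Y ω ^ 2 + 2 := by
        have := pow_le_pow_left₀ (abs_nonneg _) (abs_roundTrunc_le hi (Y ω)) 2
        rw [sq_abs] at this
        nlinarith [sq_nonneg (|Y ω| - 1), sq_abs (Y ω)]
      have h6 : Y ω ^ 2 ≤ ∑ m ∈ Finset.range i, ((m : ℝ) + 1) * e m ω := h3
      linarith
    · have h5 : roundTrunc i (Y ω) = 0 := by simp [roundTrunc, hω]
      rw [h5] at h2 ⊢
      linarith
  calc (expect E fun ω => (roundTrunc i (Y ω) - b) ^ 2)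
      ≤ expect E (fun ω => (4 + 2 * K ^ 2) +
          4 * ∑ m ∈ Finset.range i, ((m : ℝ) + 1) * e m ω) :=
        h.expect_mono (h.isSpace.mem_of_finite_range hsq.1 hsq.2)
          (H.add_mem (h.isSpace.const_mem _) h4H) hpt
    _ = (4 + 2 * K ^ 2) +
          4 * expect E (fun ω => ∑ m ∈ Finset.range i, ((m : ℝ) + 1) * e m ω) := by
        rw [h.expect_const_add h4H, h.expect_smul (by norm_num) hsH]
    _ ≤ (4 + 2 * K ^ 2) + 4 * ∑ m ∈ Finset.range i, ((m : ℝ) + 1) * expect E (e m) := by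
        have h7 := h.expect_sum_le hmH
        rw [Finset.sum_congr rfl fun m _ => h.expect_smul (by positivity) (heH m)] at h7
        linarith

/-- The Borel–Cantelli part of the truncation argument: the slab `{m < |X 1| ≤ m + 1}` is contained
in exactly `m` of the events `{|X 1| > j + 1}`, and `m 𝕍(m < |X 1| ≤ m + 1)` is at most the
expectation of `|X 1|` on the slab. -/
theorem ae_eventually_abs_le (h : IsSLSpace ℱ H E) (hX : IsIIDAdapted ℱ H E X)
    (hsum : Summable fun m : ℕ => expect E
      ({ω | (m : ℝ) < |X 1 ω| ∧ |X 1 ω| ≤ (m : ℝ) + 1}.indicator fun ω => |X 1 ω|)) :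
    ∀ᵐ ω ∂(capacityOuter E), ∀ᶠ i : ℕ in atTop, |X i ω| ≤ i := by
  have hXH : ∀ i, 1 ≤ i → X i ∈ H := fun i hi => (hX.adapted i hi).1
  have hXm : ∀ i, 1 ≤ i → Measurable fun ω => |X i ω| := fun i hi =>
    h.isSpace.measurable _ (h.isSpace.abs_mem _ (hXH i hi))
  set s : ℕ → Set Ω := fun m => {ω | (m : ℝ) < |X 1 ω| ∧ |X 1 ω| ≤ (m : ℝ) + 1} with hs
  have hsm : ∀ m, MeasurableSet (s m) := fun m =>
    (measurableSet_lt measurable_const (hXm 1 le_rfl)).inter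
      (measurableSet_le (hXm 1 le_rfl) measurable_const)
  have hmarkov : ∀ m : ℕ, m * capacityOuter E (s m) ≤
      ENNReal.ofReal (expect E ((s m).indicator fun ω => |X 1 ω|)) := by
    intro m
    rw [h.capacityOuter_apply (hsm m), ← ENNReal.ofReal_natCast,
      ← ENNReal.ofReal_mul (Nat.cast_nonneg m),
      ← h.expect_indicator_const (hsm m) (Nat.cast_nonneg m)]
    refine ENNReal.ofReal_le_ofReal (h.expect_mono (h.isSpace.indicator_const_mem (hsm m) _)
      (h.isSpace.indicator_mem _ (h.isSpace.abs_mem _ (hXH 1 le_rfl)) _ (hsm m)) fun ω => ?_)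
    by_cases hω : ω ∈ s m
    · rw [Set.indicator_of_mem hω, Set.indicator_of_mem hω]
      exact hω.1.le
    · rw [Set.indicator_of_notMem hω, Set.indicator_of_notMem hω]
  have htail : ∀ j : ℕ, capacityOuter E {ω | ((j + 1 : ℕ) : ℝ) < |X (j + 1) ω|} ≤
      ∑' m : ℕ, if j < m then capacityOuter E (s m) else 0 := by
    intro j
    have hm1 : ∀ i, 1 ≤ i → MeasurableSet {ω | ((j + 1 : ℕ) : ℝ) < |X i ω|} := fun i hi =>
      measurableSet_lt measurable_const (hXm i hi)
    have hφ : MeasurableSet {x : ℝ | ((j + 1 : ℕ) : ℝ) < |x|} :=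
      measurableSet_lt measurable_const (by fun_prop)
    have hcap : capacity E {ω | ((j + 1 : ℕ) : ℝ) < |X (j + 1) ω|} =
        capacity E {ω | ((j + 1 : ℕ) : ℝ) < |X 1 ω|} :=
      hX.law (j + 1) (by omega) ({x : ℝ | ((j + 1 : ℕ) : ℝ) < |x|}.indicator fun _ => 1)
        (measurable_const.indicator hφ) (h.isSpace.indicator_const_mem (hm1 _ (by omega)) 1)
        (h.isSpace.indicator_const_mem (hm1 1 le_rfl) 1)
    rw [h.capacityOuter_apply (hm1 _ (by omega)), hcap, ← h.capacityOuter_apply (hm1 1 le_rfl)]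
    calc capacityOuter E {ω | ((j + 1 : ℕ) : ℝ) < |X 1 ω|}
        ≤ capacityOuter E (⋃ m : ℕ, if j < m then s m else ∅) := by
          refine measure_mono fun ω hω => ?_
          have hω : ((j + 1 : ℕ) : ℝ) < |X 1 ω| := hω
          have hpos : 0 < |X 1 ω| := lt_of_le_of_lt (Nat.cast_nonneg _) hω
          obtain ⟨m, hm⟩ : ∃ m, ⌈|X 1 ω|⌉₊ = m + 1 :=
            Nat.exists_eq_succ_of_ne_zero (Nat.ceil_pos.2 hpos).ne'
          have h1 : (m : ℝ) < |X 1 ω| := Nat.lt_ceil.1 (by omega)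
          have h2 : |X 1 ω| ≤ (m : ℝ) + 1 := by
            have := Nat.le_ceil |X 1 ω|
            rw [hm] at this
            exact_mod_cast this
          have h3 : j < m := by
            have : ((j + 1 : ℕ) : ℝ) < ((m + 1 : ℕ) : ℝ) := by
              push_cast at hω ⊢
              linarith
            have := Nat.cast_lt.1 this
            omega
          refine Set.mem_iUnion.2 ⟨m, ?_⟩
          rw [if_pos h3]
          exact ⟨h1, h2⟩
      _ ≤ ∑' m : ℕ, capacityOuter E (if j < m then s m else ∅) := measure_iUnion_le _
      _ = _ := by
          congr 1
          ext m
          split_ifs <;> simp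
  have hfin : ∑' j : ℕ, capacityOuter E {ω | ((j + 1 : ℕ) : ℝ) < |X (j + 1) ω|} ≠ ⊤ := by
    refine ne_top_of_le_ne_top hsum.tsum_ofReal_ne_top ?_
    calc ∑' j : ℕ, capacityOuter E {ω | ((j + 1 : ℕ) : ℝ) < |X (j + 1) ω|}
        ≤ ∑' (j : ℕ) (m : ℕ), (if j < m then capacityOuter E (s m) else 0) :=
          ENNReal.tsum_le_tsum htail
      _ = ∑' (m : ℕ) (j : ℕ), (if j < m then capacityOuter E (s m) else 0) :=
          ENNReal.tsum_comm
      _ ≤ ∑' m : ℕ, ENNReal.ofReal (expect E ((s m).indicator fun ω => |X 1 ω|)) := by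
          refine ENNReal.tsum_le_tsum fun m => le_trans (le_of_eq ?_) (hmarkov m)
          rw [tsum_eq_sum (s := Finset.range m) fun j hj => if_neg (by simpa using hj),
            Finset.sum_congr rfl fun j hj => if_pos (Finset.mem_range.1 hj), Finset.sum_const,
            Finset.card_range, nsmul_eq_mul]
  filter_upwards [ae_eventually_notMem hfin] with ω hω
  obtain ⟨N, hN⟩ := eventually_atTop.1 hω
  filter_upwards [eventually_ge_atTop (N + 1)] with i hi
  have h1 := hN (i - 1) (by omega)
  rw [Nat.sub_add_cancel (by omega : 1 ≤ i)] at h1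
  exact not_lt.1 h1

/-- The upper half of the strong law: quasi-surely, the upper limit of the averages is at most
`ℰ(X 1)`. -/
theorem ae_eventually_average_le_expect (h : IsSLSpace ℱ H E) (hX : IsIIDAdapted ℱ H E X)
    (hsum : Summable fun m : ℕ => expect E
      ({ω | (m : ℝ) < |X 1 ω| ∧ |X 1 ω| ≤ (m : ℝ) + 1}.indicator fun ω => |X 1 ω|))
    {ε : ℝ} (hε : 0 < ε) :
    ∀ᵐ ω ∂(capacityOuter E), ∀ᶠ n : ℕ in atTop,
      (∑ i ∈ Finset.Icc 1 n, X i ω) / (n : ℝ) ≤ expect E (X 1) + ε := by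
  have hX1 : X 1 ∈ H := (hX.adapted 1 le_rfl).1
  set e : ℕ → ℝ := fun m => expect E
    ({ω | (m : ℝ) < |X 1 ω| ∧ |X 1 ω| ≤ (m : ℝ) + 1}.indicator fun ω => |X 1 ω|) with he
  have hYm := h.isSpace.measurable _ (h.isSpace.abs_mem _ hX1)
  have he0 : ∀ m, 0 ≤ e m := fun m => h.expect_nonneg
    (h.isSpace.indicator_mem _ (h.isSpace.abs_mem _ hX1) _
      ((measurableSet_lt measurable_const hYm).inter (measurableSet_le hYm measurable_const)))
    (Set.indicator_nonneg fun _ _ => abs_nonneg _)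
  set b : ℕ → ℝ := fun i => expect E fun ω => roundTrunc i (X 1 ω) with hb
  set K : ℝ := 1 + expect E fun ω => |X 1 ω| with hK
  -- The index `0` is set apart: nothing is assumed about `X 0`.
  set U : ℕ → Ω → ℝ := fun i ω => if i = 0 then 0 else roundTrunc i (X i ω) - b i with hU
  set v : ℕ → ℝ := fun i => (4 + 2 * K ^ 2) + 4 * ∑ m ∈ Finset.range i, ((m : ℝ) + 1) * e m
    with hv
  have hUs : ∀ i, IsSimple (ℱ i) (U i) := by
    intro i
    rcases Nat.eq_zero_or_pos i with rfl | hi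
    · simpa [hU] using IsSimple.const (m := ℱ 0) (0 : ℝ)
    · simp only [hU, hi.ne', if_false]
      exact (isSimple_roundTrunc (hX.adapted i hi).2 i).comp (φ := fun x => x - b i) (by fun_prop)
  have hv0 : ∀ i, 0 ≤ v i := fun i => add_nonneg (by positivity) (mul_nonneg (by norm_num)
    (Finset.sum_nonneg fun m _ => mul_nonneg (by positivity) (he0 m)))
  have hvsum : Summable fun i : ℕ => v i / (i : ℝ) ^ 2 := by
    have h1 : Summable fun i : ℕ => (4 + 2 * K ^ 2) * (1 / (i : ℝ) ^ 2) :=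
      (Real.summable_one_div_nat_pow.2 (by norm_num)).mul_left _
    have h2 := (summable_sum_mul_div_sq he0 hsum).mul_left 4
    refine (h1.add h2).congr fun i => ?_
    simp only [hv]
    ring
  have hmean : ∀ k, ∀ᵐ ω ∂(capacityOuter E), E k (U (k + 1)) ω ≤ 0 := by
    intro k
    have hUk : U (k + 1) = fun ω => roundTrunc (k + 1) (X (k + 1) ω) - b (k + 1) := by
      ext ω
      simp [hU]
    have hmem := (h.adapted_of_isSimple (hUs (k + 1))).1
    rw [hUk] at hmem ⊢
    have hXk := h.isSpace.roundTrunc_mem (hX.adapted (k + 1) (by omega)).1 (k + 1)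
    have hlaw : (expect E fun ω => roundTrunc (k + 1) (X (k + 1) ω)) = b (k + 1) :=
      hX.law (k + 1) (by omega) _ (measurable_roundTrunc _) hXk (h.isSpace.roundTrunc_mem hX1 _)
    have hzero : (expect E fun ω => roundTrunc (k + 1) (X (k + 1) ω) - b (k + 1)) = 0 := by
      have := h.expect_const_add hXk (-b (k + 1))
      rw [hlaw, neg_add_cancel] at this
      rw [← this]
      congr 1
      ext ω
      ring
    filter_upwards [h.condExpect_comp_ae_eq hX (k := k)
      (f := fun x => roundTrunc (k + 1) x - b (k + 1))
      ((measurable_roundTrunc _).sub_const _) hmem] with ω hω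
    rw [hω, hzero]
  have hvar : ∀ k, ∀ᵐ ω ∂(capacityOuter E), E k (fun ω => U (k + 1) ω ^ 2) ω ≤ v (k + 1) := by
    intro k
    have hUk : (fun ω => U (k + 1) ω ^ 2) =
        fun ω => (roundTrunc (k + 1) (X (k + 1) ω) - b (k + 1)) ^ 2 := by
      ext ω
      simp [hU]
    have hmem := (h.adapted_of_isSimple
      ((hUs (k + 1)).comp (φ := fun x => x ^ 2) (by fun_prop))).1
    rw [hUk] at hmem ⊢
    have hf : Measurable fun x => (roundTrunc (k + 1) x - b (k + 1)) ^ 2 :=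
      ((measurable_roundTrunc _).sub_const _).pow_const 2
    have hsq1 := (isSimple_roundTrunc (h.isSpace.measurable _ hX1) (k + 1)).comp
      (φ := fun x => (x - b (k + 1)) ^ 2) (by fun_prop)
    have hmem1 := h.isSpace.mem_of_finite_range hsq1.1 hsq1.2
    have hlaw := hX.law (k + 1) (by omega) _ hf hmem hmem1
    filter_upwards [h.condExpect_comp_ae_eq hX (k := k) hf hmem] with ω hω
    rw [hω, hlaw]
    exact h.expect_sq_roundTrunc_sub_le hX1 (by omega)
      (h.abs_expect_roundTrunc_le hX1 (by omega))
  have hε4 : 0 < ε / 4 := by positivity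
  filter_upwards [h.ae_eventually_average_le hUs hv0 hvsum hmean hvar hε4,
    h.ae_eventually_abs_le hX hsum] with ω hω1 hω2
  have hx : ∀ᶠ i in atTop, X i ω - U i ω ≤ expect E (X 1) + ε / 4 := by
    filter_upwards [hω2, h.eventually_expect_roundTrunc_le hX1 hε4, eventually_ge_atTop 1] with
      i h1 h2 h3
    have h4 := le_roundTrunc h3 h1
    have h5 : U i ω = roundTrunc i (X i ω) - b i := by simp [hU, show i ≠ 0 by omega]
    rw [h5]
    linarith
  filter_upwards [hω1, eventually_average_le hx hε4] with n h1 h2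
  rw [Finset.sum_sub_distrib, sub_div] at h2
  linarith

/-- The lower half of the strong law. -/
theorem ae_eventually_neg_expect_le_average (h : IsSLSpace ℱ H E) (hX : IsIIDAdapted ℱ H E X)
    (hsum : Summable fun m : ℕ => expect E
      ({ω | (m : ℝ) < |X 1 ω| ∧ |X 1 ω| ≤ (m : ℝ) + 1}.indicator fun ω => |X 1 ω|))
    {ε : ℝ} (hε : 0 < ε) :
    ∀ᵐ ω ∂(capacityOuter E), ∀ᶠ n : ℕ in atTop,
      -expect E (-X 1) - ε ≤ (∑ i ∈ Finset.Icc 1 n, X i ω) / (n : ℝ) := by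
  have hsum' : Summable fun m : ℕ => expect E
      ({ω | (m : ℝ) < |(-X 1) ω| ∧ |(-X 1) ω| ≤ (m : ℝ) + 1}.indicator fun ω => |(-X 1) ω|) := by
    simpa only [Pi.neg_apply, abs_neg] using hsum
  filter_upwards [h.ae_eventually_average_le_expect hX.neg hsum' hε] with ω hω
  filter_upwards [hω] with n hn
  simp only [Pi.neg_apply, Finset.sum_neg_distrib, neg_div] at hn
  linarith

/-- The strong law when the mean of `X 1` is certain. -/
theorem ae_tendsto_average (h : IsSLSpace ℱ H E) (hX : IsIIDAdapted ℱ H E X)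
    (hsum : Summable fun m : ℕ => expect E
      ({ω | (m : ℝ) < |X 1 ω| ∧ |X 1 ω| ≤ (m : ℝ) + 1}.indicator fun ω => |X 1 ω|))
    (hmean : expect E (X 1) = -expect E (-X 1)) :
    ∀ᵐ ω ∂(capacityOuter E),
      Tendsto (fun n : ℕ => (∑ i ∈ Finset.Icc 1 n, X i ω) / (n : ℝ)) atTop
        (𝓝 (expect E (X 1))) := by
  have h1 : ∀ᵐ ω ∂(capacityOuter E), ∀ j : ℕ, ∀ᶠ n : ℕ in atTop,
      (∑ i ∈ Finset.Icc 1 n, X i ω) / (n : ℝ) ≤ expect E (X 1) + 1 / ((j : ℝ) + 1) :=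
    ae_all_iff.2 fun j => h.ae_eventually_average_le_expect hX hsum (by positivity)
  have h2 : ∀ᵐ ω ∂(capacityOuter E), ∀ j : ℕ, ∀ᶠ n : ℕ in atTop,
      -expect E (-X 1) - 1 / ((j : ℝ) + 1) ≤ (∑ i ∈ Finset.Icc 1 n, X i ω) / (n : ℝ) :=
    ae_all_iff.2 fun j => h.ae_eventually_neg_expect_le_average hX hsum (by positivity)
  filter_upwards [h1, h2] with ω hω1 hω2
  rw [Metric.tendsto_nhds]
  intro ε hε
  obtain ⟨j, hj⟩ := exists_nat_one_div_lt hε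
  filter_upwards [hω1 j, hω2 j] with n hn1 hn2
  rw [← hmean] at hn2
  rw [Real.dist_eq, abs_lt]
  constructor <;> linarith

end IsSLSpace

/-! ### Convergent averages -/

/-- The event `{S_n / n < c eventually}` belongs to the σ-algebra generated by `X 1, X 2, …`. -/
theorem measurableSet_eventually_average_lt {Ω : Type*} (X : ℕ → Ω → ℝ) (c : ℝ) :
    MeasurableSet[⨆ k, ⨆ _ : 1 ≤ k, (borel ℝ).comap (X k)]
      {ω | ∀ᶠ n : ℕ in atTop, (∑ i ∈ Finset.Icc 1 n, X i ω) / (n : ℝ) < c} := by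
  let m : MeasurableSpace Ω := ⨆ k, ⨆ _ : 1 ≤ k, (borel ℝ).comap (X k)
  have hX : ∀ i, 1 ≤ i → Measurable[m] (X i) := fun i hi =>
    (comap_measurable (X i)).mono
      (le_iSup₂ (f := fun k (_ : 1 ≤ k) => (borel ℝ).comap (X k)) i hi) le_rfl
  have hset : {ω | ∀ᶠ n : ℕ in atTop, (∑ i ∈ Finset.Icc 1 n, X i ω) / (n : ℝ) < c} =
      ⋃ N : ℕ, ⋂ n : ℕ, ⋂ _ : N ≤ n, {ω | (∑ i ∈ Finset.Icc 1 n, X i ω) / (n : ℝ) < c} := by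
    ext ω
    simp [eventually_atTop]
  rw [hset]
  refine MeasurableSet.iUnion fun N => MeasurableSet.iInter fun n =>
    MeasurableSet.iInter fun _ => ?_
  have h1 : Measurable[m] fun ω => (∑ i ∈ Finset.Icc 1 n, X i ω) / (n : ℝ) :=
    (Finset.measurable_fun_sum _ fun i hi => hX i (Finset.mem_Icc.1 hi).1).div_const _
  exact h1 measurableSet_Iio

namespace IsSLSpace

variable {Ω : Type*} [mΩ : MeasurableSpace Ω] [Nonempty Ω] {ℱ : Filtration ℕ mΩ}
  {H : Submodule ℝ (Ω → ℝ)} {E : ℕ → (Ω → ℝ) → (Ω → ℝ)} {X : ℕ → Ω → ℝ} {Z : Ω → ℝ}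

theorem expect_congr_ae (h : IsSLSpace ℱ H E) {Y Y' : Ω → ℝ} (hY : Y ∈ H) (hY' : Y' ∈ H)
    (heq : ∀ᵐ ω ∂(capacityOuter E), Y ω = Y' ω) : expect E Y = expect E Y' :=
  le_antisymm (h.expect_le_of_ae hY hY' (heq.mono fun _ hω => hω.le))
    (h.expect_le_of_ae hY' hY (heq.mono fun _ hω => hω.ge))

theorem expect_indicator_le_add (h : IsSLSpace ℱ H E) {Y Y' : Ω → ℝ} (hY : Y ∈ H) (hY' : Y' ∈ H)
    {A : Set Ω} (hA : MeasurableSet A) :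
    expect E (A.indicator Y) ≤
      expect E (A.indicator Y') + expect E (fun ω => |Y ω - Y' ω|) := by
  have h1 := h.isSpace.indicator_mem _ hY A hA
  have h2 := h.isSpace.indicator_mem _ hY' A hA
  grw [h.expect_le_add_expect_abs_sub h1 h2]
  gcongr
  refine h.expect_mono (h.isSpace.abs_mem _ (H.sub_mem h1 h2))
    (h.isSpace.abs_mem _ (H.sub_mem hY hY')) fun ω => ?_
  by_cases hω : ω ∈ A <;> simp [hω]

theorem sum_mem_adaptedPart (hX : IsIIDAdapted ℱ H E X) {k : ℕ} {s : Finset ℕ}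
    (hs : s ⊆ Finset.Icc 1 k) :
    (fun ω => ∑ i ∈ s, X i ω) ∈ adaptedPart ℱ H k := by
  constructor
  · have := H.sum_mem (t := s) (f := X) fun i hi =>
      (hX.adapted i (Finset.mem_Icc.1 (hs hi)).1).1
    convert this using 1
    ext ω
    simp
  · exact Finset.measurable_fun_sum _ fun i hi =>
      (hX.adapted i (Finset.mem_Icc.1 (hs hi)).1).2.mono
        (ℱ.mono (Finset.mem_Icc.1 (hs hi)).2) le_rfl

/-- Under the expectation, the increments of the partial sums after time `k` may be replaced on an
event of `ℱ k` by their means. -/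
theorem expect_add_indicator_sum (h : IsSLSpace ℱ H E) (hX : IsIIDAdapted ℱ H E X) {k n : ℕ}
    (hkn : k ≤ n) {A : Set Ω} (hA : MeasurableSet[ℱ k] A) {W : Ω → ℝ}
    (hW : W ∈ adaptedPart ℱ H k) :
    expect E (fun ω => W ω + A.indicator (fun ω => ∑ i ∈ Finset.Ioc k n, X i ω) ω) =
      expect E (fun ω => W ω + A.indicator (fun _ => ((n : ℝ) - k) * expect E (X 1)) ω) := by
  induction n, hkn using Nat.le_induction generalizing W with
  | base => simp
  | succ n hkn ih =>
    have hAn : MeasurableSet[ℱ n] A := ℱ.mono hkn A hA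
    have hXn : X (n + 1) ∈ H := (hX.adapted (n + 1) (by omega)).1
    have hlaw : expect E (X (n + 1)) = expect E (X 1) :=
      hX.law (n + 1) (by omega) (fun x => x) measurable_id hXn (hX.adapted 1 le_rfl).1
    have hsum : (fun ω => ∑ i ∈ Finset.Ioc k n, X i ω) ∈ adaptedPart ℱ H n :=
      sum_mem_adaptedPart hX fun i hi => by
        simp only [Finset.mem_Ioc, Finset.mem_Icc] at hi ⊢
        omega
    have hWs : (fun ω => W ω + A.indicator (fun ω => ∑ i ∈ Finset.Ioc k n, X i ω) ω) ∈
        adaptedPart ℱ H n := by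
      have h1 := h.indicator_mem_adaptedPart hsum hAn
      exact ⟨H.add_mem hW.1 h1.1, (hW.2.mono (ℱ.mono hkn) le_rfl).add h1.2⟩
    have hiX := h.isSpace.indicator_mem _ hXn A (ℱ.le n A hAn)
    have hc : ∀ c : ℝ, A.indicator (fun _ => c) ∈ adaptedPart ℱ H k := fun c =>
      h.indicator_mem_adaptedPart ⟨h.isSpace.const_mem c, measurable_const⟩ hA
    have hcond := h.condExpect_comp_ae_eq hX (k := n) (f := fun x => x) measurable_id hXn
    calc expect E (fun ω => W ω + A.indicator (fun ω => ∑ i ∈ Finset.Ioc k (n + 1), X i ω) ω)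
        = expect E (fun ω => (W ω + A.indicator (fun ω => ∑ i ∈ Finset.Ioc k n, X i ω) ω) +
            A.indicator (X (n + 1)) ω) := by
          congr 1
          ext ω
          by_cases hω : ω ∈ A
          · simp only [Set.indicator_of_mem hω, Finset.sum_Ioc_succ_top hkn]
            ring
          · simp [hω]
      _ = expect E (fun ω => (W ω + A.indicator (fun ω => ∑ i ∈ Finset.Ioc k n, X i ω) ω) +
            E n (A.indicator (X (n + 1))) ω) := h.expect_add_condExpect hWs hiX
      _ = expect E (fun ω => (W ω + A.indicator (fun _ => expect E (X 1)) ω) +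
            A.indicator (fun ω => ∑ i ∈ Finset.Ioc k n, X i ω) ω) := by
          refine h.expect_congr_ae (H.add_mem hWs.1 (h.condExpect_mem n hiX))
            (H.add_mem (H.add_mem hW.1 (hc _).1) (h.indicator_mem_adaptedPart hsum hAn).1) ?_
          filter_upwards [hcond] with ω hω
          rw [h.isSL.indicator n A hAn _ hXn]
          by_cases hωA : ω ∈ A
          · simp only [Set.indicator_of_mem hωA]
            rw [show E n (X (n + 1)) ω = expect E (X 1) from hω.trans hlaw]
            ring
          · simp [hωA]
      _ = expect E (fun ω => (W ω + A.indicator (fun _ => expect E (X 1)) ω) +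
            A.indicator (fun _ => ((n : ℝ) - k) * expect E (X 1)) ω) :=
          ih ⟨H.add_mem hW.1 (hc _).1, hW.2.add (hc _).2⟩
      _ = _ := by
          congr 1
          ext ω
          by_cases hω : ω ∈ A
          · simp only [Set.indicator_of_mem hω]
            push_cast
            ring
          · simp [hω]

theorem average_mem (hX : IsIIDAdapted ℱ H E X) (n : ℕ) :
    (fun ω => (∑ i ∈ Finset.Icc 1 n, X i ω) / (n : ℝ)) ∈ H := by
  have := H.smul_mem ((n : ℝ)⁻¹) (sum_mem_adaptedPart hX (subset_refl (Finset.Icc 1 n))).1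
  convert this using 1
  ext ω
  simp only [Pi.smul_apply, smul_eq_mul]
  ring

/-- Uniform integrability of the averages: quasi-sure convergence implies convergence in mean. -/
theorem tendsto_expect_abs_average_sub (h : IsSLSpace ℱ H E) (hX : IsIIDAdapted ℱ H E X)
    (hZ : Z ∈ H)
    (hlim : ∀ᵐ ω ∂(capacityOuter E),
      Tendsto (fun n : ℕ => (∑ i ∈ Finset.Icc 1 n, X i ω) / (n : ℝ)) atTop (𝓝 (Z ω))) :
    Tendsto (fun n : ℕ => expect E fun ω => |(∑ i ∈ Finset.Icc 1 n, X i ω) / (n : ℝ) - Z ω|)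
      atTop (𝓝 0) := by
  have hX1 : X 1 ∈ H := (hX.adapted 1 le_rfl).1
  have hdH : ∀ n : ℕ, (fun ω => |(∑ i ∈ Finset.Icc 1 n, X i ω) / (n : ℝ) - Z ω|) ∈ H := fun n =>
    h.isSpace.abs_mem _ (H.sub_mem (average_mem hX n) hZ)
  have hZa := h.isSpace.abs_mem Z hZ
  rw [Metric.tendsto_atTop]
  intro δ hδ
  have hδ4 : 0 < δ / 4 := by positivity
  obtain ⟨L, hL⟩ := ((h.tendsto_expect_tail hX1).eventually_lt_const hδ4).exists
  -- `t` is the part of `|x|` above the level `L`, whose expectation is small for every `X i`.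
  set t : ℝ → ℝ := {x : ℝ | (L : ℝ) < |x|}.indicator fun x => |x| with ht
  have htm : Measurable t :=
    Measurable.indicator (by fun_prop) (measurableSet_lt measurable_const (by fun_prop))
  have htH : ∀ i, 1 ≤ i → (fun ω => t (X i ω)) ∈ H := fun i hi =>
    h.isSpace.indicator_mem _ (h.isSpace.abs_mem _ (hX.adapted i hi).1) _
      (measurableSet_lt measurable_const
        (h.isSpace.measurable _ (h.isSpace.abs_mem _ (hX.adapted i hi).1)))
  have ht0 : ∀ x, 0 ≤ t x := fun x => Set.indicator_nonneg (fun _ _ => abs_nonneg _) x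
  have hxt : ∀ x : ℝ, |x| ≤ L + t x := by
    intro x
    by_cases hx : (L : ℝ) < |x|
    · simp [ht, hx]
    · simp only [ht, Set.indicator, Set.mem_ofPred_eq, hx, if_false]
      linarith
  set G : ℕ → Set Ω :=
    fun n => {ω | δ / 4 < |(∑ i ∈ Finset.Icc 1 n, X i ω) / (n : ℝ) - Z ω|} with hG
  have hGm : ∀ n, MeasurableSet (G n) := fun n =>
    measurableSet_lt measurable_const (h.isSpace.measurable _ (hdH n))
  have hG0 := h.tendsto_capacity_of_ae (average_mem hX) hZ hlim hδ4
  have hGZ := h.tendsto_expect_indicator hZ hGm hG0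
  have hGL : Tendsto (fun n => (L : ℝ) * capacity E (G n)) atTop (𝓝 0) := by
    simpa using hG0.const_mul (L : ℝ)
  obtain ⟨N, hN⟩ := eventually_atTop.1 ((hGZ.eventually_lt_const hδ4).and
    (hGL.eventually_lt_const hδ4))
  refine ⟨max N 1, fun n hn => ?_⟩
  have hn1 : 1 ≤ n := (le_max_right _ _).trans hn
  have hn0 : (0 : ℝ) < n := by exact_mod_cast hn1
  obtain ⟨hN1, hN2⟩ := hN n ((le_max_left _ _).trans hn)
  rw [Real.dist_eq, sub_zero, abs_of_nonneg (h.expect_nonneg (hdH n) fun _ => abs_nonneg _)]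
  have hi1 := h.isSpace.indicator_const_mem (hGm n) (L : ℝ)
  have hi2 := h.isSpace.indicator_mem _ hZa _ (hGm n)
  have hsH : (fun ω => ∑ i ∈ Finset.Icc 1 n, t (X i ω)) ∈ H := by
    have := H.sum_mem (t := Finset.Icc 1 n) (f := fun i ω => t (X i ω)) fun i hi =>
      htH i (Finset.mem_Icc.1 hi).1
    convert this using 1
    ext ω
    simp
  have hi3 : (fun ω => (n : ℝ)⁻¹ * ∑ i ∈ Finset.Icc 1 n, t (X i ω)) ∈ H :=
    H.smul_mem ((n : ℝ)⁻¹) hsH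
  have h12 := H.add_mem hi1 hi2
  have h123 := H.add_mem h12 hi3
  have htail : expect E (fun ω => (n : ℝ)⁻¹ * ∑ i ∈ Finset.Icc 1 n, t (X i ω)) ≤
      expect E fun ω => t (X 1 ω) := by
    rw [h.expect_smul (by positivity) hsH, inv_mul_le_iff₀ hn0]
    refine (h.expect_sum_le fun i hi => htH i (Finset.mem_Icc.1 hi).1).trans (le_of_eq ?_)
    rw [Finset.sum_congr rfl fun i hi => hX.law i (Finset.mem_Icc.1 hi).1 t htm
      (htH i (Finset.mem_Icc.1 hi).1) (htH 1 le_rfl)]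
    simp
  have hpt : ∀ ω, |(∑ i ∈ Finset.Icc 1 n, X i ω) / (n : ℝ) - Z ω| ≤
      δ / 4 + (((G n).indicator (fun _ => (L : ℝ)) ω + (G n).indicator (fun ω => |Z ω|) ω) +
        (n : ℝ)⁻¹ * ∑ i ∈ Finset.Icc 1 n, t (X i ω)) := by
    intro ω
    have hs0 : 0 ≤ (n : ℝ)⁻¹ * ∑ i ∈ Finset.Icc 1 n, t (X i ω) :=
      mul_nonneg (by positivity) (Finset.sum_nonneg fun i _ => ht0 _)
    by_cases hω : ω ∈ G n
    · simp only [Set.indicator_of_mem hω]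
      have h1 : |(∑ i ∈ Finset.Icc 1 n, X i ω) / (n : ℝ)| ≤
          L + (n : ℝ)⁻¹ * ∑ i ∈ Finset.Icc 1 n, t (X i ω) := by
        rw [abs_div, abs_of_pos hn0, div_le_iff₀ hn0, add_mul, mul_comm, mul_right_comm,
          inv_mul_cancel₀ hn0.ne', one_mul]
        calc |∑ i ∈ Finset.Icc 1 n, X i ω| ≤ ∑ i ∈ Finset.Icc 1 n, |X i ω| :=
              Finset.abs_sum_le_sum_abs _ _
          _ ≤ ∑ i ∈ Finset.Icc 1 n, ((L : ℝ) + t (X i ω)) := Finset.sum_le_sum fun i _ => hxt _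
          _ = _ := by simp [Finset.sum_add_distrib]
      have h2 := abs_sub ((∑ i ∈ Finset.Icc 1 n, X i ω) / (n : ℝ)) (Z ω)
      linarith
    · simp only [Set.indicator_of_notMem hω]
      have h1 : ¬ δ / 4 < |(∑ i ∈ Finset.Icc 1 n, X i ω) / (n : ℝ) - Z ω| := hω
      rw [not_lt] at h1
      linarith
  have hle := h.expect_mono (hdH n) (H.add_mem (h.isSpace.const_mem (δ / 4)) h123) hpt
  have h5 := h.expect_const_add h123 (δ / 4)
  have h6 := h.expect_add_le h12 hi3
  have h7 := h.expect_add_le hi1 hi2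
  rw [h.expect_indicator_const (hGm n) (Nat.cast_nonneg L)] at h7
  have hL' : (expect E fun ω => t (X 1 ω)) < δ / 4 := hL
  have h8 := hle.trans_eq h5
  have h9 := h6.trans (add_le_add h7 htail)
  exact lt_of_le_of_lt (h8.trans (add_le_add le_rfl h9)) (by linarith)

/-- If the averages converge to `Z`, then `ℰ(I_A (Z - c))` is at least `(ℰ(X 1) - c) 𝕍(A)` for
every event `A` that is known at a finite time. -/
theorem mul_capacity_le_expect_indicator (h : IsSLSpace ℱ H E) (hX : IsIIDAdapted ℱ H E X)
    (hZ : Z ∈ H)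
    (hlim : ∀ᵐ ω ∂(capacityOuter E),
      Tendsto (fun n : ℕ => (∑ i ∈ Finset.Icc 1 n, X i ω) / (n : ℝ)) atTop (𝓝 (Z ω)))
    {k : ℕ} {A : Set Ω} (hA : MeasurableSet[ℱ k] A) {c : ℝ} (hc : c ≤ expect E (X 1)) :
    (expect E (X 1) - c) * capacity E A ≤ expect E (A.indicator fun ω => Z ω - c) := by
  set μ := expect E (X 1) with hμ
  have hA' : MeasurableSet A := ℱ.le k A hA
  have hSk := sum_mem_adaptedPart hX (subset_refl (Finset.Icc 1 k))
  have hcm : ∀ c : ℝ, (fun _ => c) ∈ H := h.isSpace.const_mem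
  set M := expect E fun ω => |(∑ i ∈ Finset.Icc 1 k, X i ω) - k * μ| with hM
  have hbound : ∀ᶠ n : ℕ in atTop, (μ - c) * capacity E A ≤
      expect E (A.indicator fun ω => Z ω - c) +
        (expect E fun ω => |(∑ i ∈ Finset.Icc 1 n, X i ω) / (n : ℝ) - Z ω|) + M / n := by
    filter_upwards [eventually_ge_atTop (max k 1)] with n hn
    have hkn : k ≤ n := (le_max_left _ _).trans hn
    have hn0 : (0 : ℝ) < n := by exact_mod_cast (le_max_right _ _).trans hn
    have havg := average_mem hX n
    -- `W = I_A (S_k - n c)`, so that `W + I_A (S_n - S_k) = n I_A (S_n / n - c)`.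
    have hW : A.indicator (fun ω => (∑ i ∈ Finset.Icc 1 k, X i ω) - n * c) ∈
        adaptedPart ℱ H k :=
      h.indicator_mem_adaptedPart ⟨H.sub_mem hSk.1 (hcm _), hSk.2.sub measurable_const⟩ hA
    have h1 := h.expect_add_indicator_sum hX hkn hA hW
    have hl : (fun ω => A.indicator (fun ω => (∑ i ∈ Finset.Icc 1 k, X i ω) - n * c) ω +
        A.indicator (fun ω => ∑ i ∈ Finset.Ioc k n, X i ω) ω) =
        fun ω => (n : ℝ) *
          A.indicator (fun ω => (∑ i ∈ Finset.Icc 1 n, X i ω) / (n : ℝ) - c) ω := by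
      ext ω
      by_cases hω : ω ∈ A
      · simp only [Set.indicator_of_mem hω]
        rw [mul_sub, mul_div_cancel₀ _ hn0.ne', sub_add_eq_add_sub,
          ← Finset.sum_union (Finset.disjoint_left.2 fun i hi hi' => by
            simp only [Finset.mem_Icc, Finset.mem_Ioc] at hi hi'; omega)]
        congr 2
        ext i
        simp only [Finset.mem_Icc, Finset.mem_Ioc, Finset.mem_union]
        omega
      · simp [hω]
    have hr : (fun ω => A.indicator (fun ω => (∑ i ∈ Finset.Icc 1 k, X i ω) - n * c) ω +
        A.indicator (fun _ => ((n : ℝ) - k) * μ) ω) =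
        A.indicator fun ω => (n : ℝ) * (μ - c) + ((∑ i ∈ Finset.Icc 1 k, X i ω) - k * μ) := by
      ext ω
      by_cases hω : ω ∈ A
      · simp only [Set.indicator_of_mem hω]
        ring
      · simp [hω]
    have hac : (fun ω => (∑ i ∈ Finset.Icc 1 n, X i ω) / (n : ℝ) - c) ∈ H :=
      H.sub_mem havg (hcm c)
    rw [hl, hr, h.expect_smul hn0.le (h.isSpace.indicator_mem _ hac A hA')] at h1
    have hSkμ : (fun ω => (∑ i ∈ Finset.Icc 1 k, X i ω) - k * μ) ∈ H := H.sub_mem hSk.1 (hcm _)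
    have h2 := h.expect_indicator_le_add (hcm ((n : ℝ) * (μ - c)))
      (H.add_mem (hcm ((n : ℝ) * (μ - c))) hSkμ) hA'
    rw [h.expect_indicator_const hA' (mul_nonneg hn0.le (sub_nonneg.2 hc))] at h2
    have hM' : (expect E fun ω => |(n : ℝ) * (μ - c) - ((fun _ : Ω => (n : ℝ) * (μ - c)) +
        fun ω => (∑ i ∈ Finset.Icc 1 k, X i ω) - k * μ : Ω → ℝ) ω|) = M := by
      rw [hM]
      congr 1
      ext ω
      simp only [Pi.add_apply]
      rw [sub_add_cancel_left, abs_neg]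
    rw [hM'] at h2
    have h3 : (n : ℝ) * ((μ - c) * capacity E A) ≤ n *
        expect E (A.indicator fun ω => (∑ i ∈ Finset.Icc 1 n, X i ω) / (n : ℝ) - c) + M := by
      rw [h1, ← mul_assoc]
      exact h2
    have h4 := h.expect_indicator_le_add hac (H.sub_mem hZ (hcm c)) hA'
    simp only [Pi.sub_apply, sub_sub_sub_cancel_right] at h4
    have h5 : (μ - c) * capacity E A ≤
        expect E (A.indicator fun ω => (∑ i ∈ Finset.Icc 1 n, X i ω) / (n : ℝ) - c) + M / n := by
      rw [← mul_le_mul_iff_right₀ hn0, mul_add, mul_div_cancel₀ _ hn0.ne']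
      exact h3
    have h6 : expect E (A.indicator (Z - fun _ => c)) =
        expect E (A.indicator fun ω => Z ω - c) := rfl
    linarith
  have hlim2 := ((h.tendsto_expect_abs_average_sub hX hZ hlim).const_add
    (expect E (A.indicator fun ω => Z ω - c))).add (tendsto_const_div_atTop_nhds_zero_nat M)
  rw [add_zero, add_zero] at hlim2
  exact ge_of_tendsto hlim2 hbound

/-- Under Assumption (A) a quasi-sure limit of the averages is at least `ℰ(X 1)`: the bound of
`mul_capacity_le_expect_indicator` extends to the event `{S_n / n < c eventually}`, on which
`Z ≤ c`, and forces its capacity to vanish when `c < ℰ(X 1)`. -/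
theorem ae_expect_le_of_tendsto_average (h : IsSLSpace ℱ H E) (hX : IsIIDAdapted ℱ H E X)
    (hZ : Z ∈ H) (hAss : AssumptionA H E)
    (hlim : ∀ᵐ ω ∂(capacityOuter E),
      Tendsto (fun n : ℕ => (∑ i ∈ Finset.Icc 1 n, X i ω) / (n : ℝ)) atTop (𝓝 (Z ω))) :
    ∀ᵐ ω ∂(capacityOuter E), expect E (X 1) ≤ Z ω := by
  have key : ∀ ε > 0, ∀ᵐ ω ∂(capacityOuter E), expect E (X 1) - ε ≤ Z ω := by
    intro ε hε
    set c := expect E (X 1) - ε with hc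
    set B : Set Ω := {ω | ∀ᶠ n : ℕ in atTop, (∑ i ∈ Finset.Icc 1 n, X i ω) / (n : ℝ) < c} with hB
    have hBX := measurableSet_eventually_average_lt X c
    have hBm : MeasurableSet B := (iSup₂_le fun k hk =>
      (h.isSpace.measurable _ (hX.adapted k hk).1).comap_le) B hBX
    have hBle : ∀ᵐ ω ∂(capacityOuter E), ω ∈ B → Z ω ≤ c := by
      filter_upwards [hlim] with ω hω hωB
      have hωB : ∀ᶠ n : ℕ in atTop, (∑ i ∈ Finset.Icc 1 n, X i ω) / (n : ℝ) < c := hωB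
      exact le_of_tendsto hω (hωB.mono fun _ hn => hn.le)
    obtain ⟨Bn, hBn, hBn0⟩ := hAss X (fun n hn => (hX.adapted n hn).1) B hBX
    have hBnF : ∀ n, MeasurableSet[ℱ (n + 1)] (Bn (n + 1)) := by
      intro n
      have hle : (⨆ k ∈ Finset.Icc 1 (n + 1), (borel ℝ).comap (X k)) ≤ ℱ (n + 1) :=
        iSup₂_le fun k hk => ((hX.adapted k (Finset.mem_Icc.1 hk).1).2.comap_le).trans
          (ℱ.mono (Finset.mem_Icc.1 hk).2)
      exact hle _ (hBn (n + 1) (by omega))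
    have hBnm : ∀ n, MeasurableSet (Bn (n + 1)) := fun n => ℱ.le _ _ (hBnF n)
    set D : ℕ → Set Ω := fun n => (Bn (n + 1) \ B) ∪ (B \ Bn (n + 1)) with hD
    have hDm : ∀ n, MeasurableSet (D n) := fun n =>
      ((hBnm n).diff hBm).union (hBm.diff (hBnm n))
    have hD0 : Tendsto (fun n => capacity E (D n)) atTop (𝓝 0) :=
      hBn0.comp (tendsto_add_atTop_nat 1)
    have hZc : (fun ω => Z ω - c) ∈ H := H.sub_mem hZ (h.isSpace.const_mem c)
    have hDZ := h.tendsto_expect_indicator hZc hDm hD0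
    have hBneg : expect E (B.indicator fun ω => Z ω - c) ≤ 0 := by
      rw [← h.expect_const 0]
      refine h.expect_le_of_ae (h.isSpace.indicator_mem _ hZc B hBm) (h.isSpace.const_mem 0) ?_
      filter_upwards [hBle] with ω hω
      exact Set.indicator_apply_le' (fun hωB => by linarith [hω hωB]) fun _ => le_rfl
    have hBcap : ∀ n, ε * capacity E B ≤
        expect E ((D n).indicator fun ω => |Z ω - c|) + ε * capacity E (D n) := by
      intro n
      have h1 := h.mul_capacity_le_expect_indicator hX hZ hlim (hBnF n) (c := c) (by linarith)
      have hi1 := h.isSpace.indicator_mem _ hZc B hBm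
      have hi2 := h.isSpace.indicator_mem _ (h.isSpace.abs_mem _ hZc) _ (hDm n)
      have h2 : expect E ((Bn (n + 1)).indicator fun ω => Z ω - c) ≤
          expect E (B.indicator fun ω => Z ω - c) +
            expect E ((D n).indicator fun ω => |Z ω - c|) := by
        refine le_trans (h.expect_mono (h.isSpace.indicator_mem _ hZc _ (hBnm n))
          (H.add_mem hi1 hi2) fun ω => ?_) (h.expect_add_le hi1 hi2)
        have h3 := le_abs_self (Z ω - c)
        have h4 := neg_abs_le (Z ω - c)
        by_cases hω : ω ∈ B <;> by_cases hω' : ω ∈ Bn (n + 1)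
        · simp [hD, hω, hω']
        · simp only [Set.indicator, hω', if_false, Pi.add_apply, hω, if_true, hD, Set.mem_union,
            Set.mem_sdiff, not_true, and_false, not_false_eq_true, and_true, or_true]
          linarith
        · simp only [Set.indicator, hω', if_true, Pi.add_apply, hω, if_false, hD, Set.mem_union,
            Set.mem_sdiff, not_true, and_false, not_false_eq_true, and_true, or_false]
          linarith
        · simp [hD, hω, hω']
      have h5 : capacity E B ≤ capacity E (Bn (n + 1)) + capacity E (D n) := by
        refine (h.capacity_mono hBm ((hBnm n).union (hDm n)) fun ω hω => ?_).trans
          (h.capacity_union_le (hBnm n) (hDm n))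
        by_cases hω' : ω ∈ Bn (n + 1)
        · exact Or.inl hω'
        · exact Or.inr (Or.inr ⟨hω, hω'⟩)
      have h6 := mul_le_mul_of_nonneg_left h5 hε.le
      rw [hc, sub_sub_cancel] at h1
      linarith
    have hlim2 := hDZ.add (hD0.const_mul ε)
    rw [mul_zero, add_zero] at hlim2
    have hB0 : capacity E B = 0 := by
      have h1 := ge_of_tendsto' hlim2 hBcap
      have h2 := h.capacity_nonneg hBm
      nlinarith
    have hBae : ∀ᵐ ω ∂(capacityOuter E), ω ∉ B :=
      h.quasiSurely_iff.1 ⟨B, hBm, hB0, fun _ hω => hω⟩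
    filter_upwards [hBae, hlim] with ω hω1 hω2
    by_contra hlt
    exact hω1 (hω2.eventually_lt_const (not_le.1 hlt))
  have hall : ∀ᵐ ω ∂(capacityOuter E), ∀ n : ℕ, expect E (X 1) - 1 / ((n : ℝ) + 1) ≤ Z ω :=
    ae_all_iff.2 fun n => key _ (by positivity)
  filter_upwards [hall] with ω hω
  have hlim3 := (tendsto_one_div_add_atTop_nhds_zero_nat (𝕜 := ℝ)).const_sub (expect E (X 1))
  rw [sub_zero] at hlim3
  exact le_of_tendsto' hlim3 hω

/-- A property that holds quasi-surely holds somewhere, as the whole space has capacity `1`. -/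
theorem exists_of_ae (h : IsSLSpace ℱ H E) {P : Ω → Prop}
    (hP : ∀ᵐ ω ∂(capacityOuter E), P ω) : ∃ ω, P ω := by
  obtain ⟨N, -, hN0, hNP⟩ := h.quasiSurely_iff.2 hP
  by_contra hne
  have hN : N = Set.univ := Set.eq_univ_of_forall fun ω => by
    by_contra hω
    exact hne ⟨ω, hNP ω hω⟩
  rw [hN, h.capacity_univ] at hN0
  exact one_ne_zero hN0

/-- The converse of the strong law under Assumption (A). -/
theorem expect_eq_and_ae_eq_of_tendsto_average (h : IsSLSpace ℱ H E) (hX : IsIIDAdapted ℱ H E X)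
    (hZ : Z ∈ H) (hAss : AssumptionA H E)
    (hlim : ∀ᵐ ω ∂(capacityOuter E),
      Tendsto (fun n : ℕ => (∑ i ∈ Finset.Icc 1 n, X i ω) / (n : ℝ)) atTop (𝓝 (Z ω))) :
    expect E (X 1) = -expect E (-X 1) ∧ ∀ᵐ ω ∂(capacityOuter E), Z ω = expect E (X 1) := by
  have hlo := h.ae_expect_le_of_tendsto_average hX hZ hAss hlim
  have hhi := h.ae_expect_le_of_tendsto_average hX.neg (H.neg_mem hZ) hAss (by
    filter_upwards [hlim] with ω hω
    simpa only [Pi.neg_apply, Finset.sum_neg_distrib, neg_div] using hω.neg)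
  have hle := h.neg_expect_neg_le (hX.adapted 1 le_rfl).1
  obtain ⟨ω₀, h1, h2⟩ := h.exists_of_ae (hlo.and hhi)
  rw [Pi.neg_apply] at h2
  have heq : expect E (X 1) = -expect E (-X 1) := by linarith
  refine ⟨heq, ?_⟩
  filter_upwards [hlo, hhi] with ω hω1 hω2
  rw [Pi.neg_apply] at hω2
  linarith

end IsSLSpace

end SublinearLLN

theorem mainTheorem1 {Ω : Type*} [mΩ : MeasurableSpace Ω] [Nonempty Ω]
    (ℱ : Filtration ℕ mΩ) (hℱ_zero : ℱ 0 = ⊥) (hℱ_top : ⨆ t, ℱ t = mΩ)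
    (H : Submodule ℝ (Ω → ℝ)) (hH : SublinearLLN.IsRandomVariableSpace H)
    (E : ℕ → (Ω → ℝ) → (Ω → ℝ)) (hE : SublinearLLN.IsSLExpectation ℱ H E)
    (X : ℕ → Ω → ℝ)
    (hX_adapted : ∀ i, 1 ≤ i → X i ∈ SublinearLLN.adaptedPart ℱ H i)
    (hX_indep : ∀ i, 1 ≤ i → SublinearLLN.IndepOfSigma H E (X i) (ℱ (i - 1)))
    (hX_law : ∀ i, 1 ≤ i → SublinearLLN.SameLaw H E (X i) (X 1))
    (hX_sum : Summable fun m : ℕ => SublinearLLN.expect E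
      ({ω | (m : ℝ) < |X 1 ω| ∧ |X 1 ω| ≤ (m : ℝ) + 1}.indicator fun ω => |X 1 ω|)) :
    (SublinearLLN.expect E (X 1) = -SublinearLLN.expect E (-X 1) →
      SublinearLLN.QuasiSurely E fun ω =>
        Tendsto (fun n : ℕ => (∑ i ∈ Finset.Icc 1 n, X i ω) / (n : ℝ)) atTop
          (𝓝 (SublinearLLN.expect E (X 1)))) ∧
    (∀ Z ∈ H,
      (SublinearLLN.QuasiSurely E fun ω =>
        Tendsto (fun n : ℕ => (∑ i ∈ Finset.Icc 1 n, X i ω) / (n : ℝ)) atTop (𝓝 (Z ω))) →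
      SublinearLLN.AssumptionA H E →
      SublinearLLN.expect E (X 1) = -SublinearLLN.expect E (-X 1) ∧
        SublinearLLN.QuasiSurely E fun ω => Z ω = SublinearLLN.expect E (X 1)) := by
  have h : SublinearLLN.IsSLSpace ℱ H E := ⟨hH, hE, hℱ_zero⟩
  have hX : SublinearLLN.IsIIDAdapted ℱ H E X := ⟨hX_adapted, hX_indep, hX_law⟩
  refine ⟨fun hmean => h.quasiSurely_iff.2 (h.ae_tendsto_average hX hX_sum hmean),
    fun Z hZ hlim hA => ?_⟩
  obtain ⟨h1, h2⟩ :=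
    h.expect_eq_and_ae_eq_of_tendsto_average hX hZ hA (h.quasiSurely_iff.1 hlim)
  exact ⟨h1, h.quasiSurely_iff.2 h2⟩
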